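/- **Corollary (Companions and conjoints of natural transformations, pseudo case).** Let $\mathbb{D}$ and $\mathbb{E}$ be (pseudo) double categories, with arrows composed strictly and proarrows $x \nrightarrow y$ composed up to coherent isomorphism by $\odot$; write $\mathrm{id}_x$ and $\mathrm{id}_f$ for external identities, and $\cdot$ for the internal (strict) composition of cells in diagrammatic order. A *companion* of an arrow $f : x \to y$ is a proarrow $f_! : x \nrightarrow y$ with cells $\eta$ from $\mathrm{id}_x$ (top) to $f_!$ (bottom), with left boundary $1_x$ and right boundary $f$, and $\varepsilon$ from $f_!$ to $\mathrm{id}_y$, with left boundary $f$ and right boundary $1_y$, such that $\eta \odot \varepsilon = 1_{f_!}$ (up to the unit isomorphisms) and $\eta \cdot \varepsilon = \mathrm{id}_f$. Dually, a *conjoint* of $f$ is a proarrow $f^* : y \nrightarrow x$ with cells $\eta$ from $\mathrm{id}_x$ to $f^*$ (left boundary $f$, right boundary $1_x$) and $\varepsilon$ from $f^*$ to $\mathrm{id}_y$ (left boundary $1_y$, right boundary $f$) such that $\varepsilon \odot \eta = 1_{f^*}$ (up to the unit isomorphisms) and $\eta \cdot \varepsilon = \mathrm{id}_f$. Let $\theta$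 be a cell with top $m : x \nrightarrow y$, bottom $n : w \nrightarrow z$, left boundary $f : x \to w$ and right boundary $g : y \to z$. It is a *commuter* if $f$ and $g$ have companions and the globular cell $\theta_! : m \odot g_! \to f_! \odot n$ given, up to unit isomorphisms, by $\eta_f \odot \theta \odot \varepsilon_g$ is an isomorphism (for any choice of companions). It is a *cocommuter* if $f$ and $g$ have conjoints and the globular cell $\theta^* : f^* \odot m \to n \odot g^*$ given, up to unit isomorphisms, by $\varepsilon_f \odot \theta \odot \eta_g$ is an isomorphism (for any choice of conjoints). Let $\mathrm{Lax}_{\mathrm{ps}}(\mathbb{D},\mathbb{E})$ be the double category whose objects are lax double functors $\mathbb{D} \to \mathbb{E}$, whose arrows are (strict) natural transformations, whose proarrows $F \nrightarrow G$ are pseudo protransformations, and whose cells are modifications, composed componentwise. Here a pseudo protransformation $\tau : F \nrightarrow G$ consists of proarrows $\tau_x : Fx \nrightarrow Gx$, cells $\tau_f$ from $\tau_x$ to $\tau_y$ with left boundary $Ff$ and right boundary $Gf$, functorial in $f : x \to y$, and invertible globular cells $\tau_m : \tau_x \odot Gm \to Fm \odot \tau_y$ for proarrows $m : x \nrightarrow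 y$, natural with respect to cells and coherent with respect to external composition and identities. A modification with top $\sigma : F \nrightarrow G$, bottom $\tau : H \nrightarrow K$, left boundary $\alpha : F \Rightarrow H$ and right boundary $\beta : G \Rightarrow K$ consists of cells $\mu_x$ from $\sigma_x$ to $\tau_x$ with left boundary $\alpha_x$ and right boundary $\beta_x$, such that $\mu_x \cdot \tau_f = \sigma_f \cdot \mu_y$ for every arrow $f : x \to y$ and $(\mu_x \odot \beta_m) \cdot \tau_m = \sigma_m \cdot (\alpha_m \odot \mu_y)$ for every proarrow $m : x \nrightarrow y$. Let $\alpha : F \Rightarrow G$ be a natural transformation between lax double functors $F, G : \mathbb{D} \to \mathbb{E}$. Then: 1. $\alpha$ has a companion in $\mathrm{Lax}_{\mathrm{ps}}(\mathbb{D},\mathbb{E})$, which is a pseudo protransformation $\alpha_! : F \nrightarrow G$, if and only if for every object $x$ of $\mathbb{D}$ the component arrow $\alpha_x : Fx \to Gx$ has a companion in $\mathbb{E}$ and for every proarrow $m$ of $\mathbb{D}$ the component cell $\alpha_m$ is a commuter. 2. $\alpha$ has a conjoint in $\mathrm{Lax}_{\mathrm{ps}}(\mathbb{D},\mathbb{E})$,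 which is a pseudo protransformation $\alpha^* : G \nrightarrow F$, if and only if for every object $x$ of $\mathbb{D}$ the component arrow $\alpha_x$ has a conjoint in $\mathbb{E}$ and for every proarrow $m$ of $\mathbb{D}$ the component cell $\alpha_m$ is a cocommuter. -/

import Mathlib

open CategoryTheory

universe t w v u t₁ w₁ v₁ u₁ t₂ w₂ v₂ u₂

namespace DoubleCat

/-- A proarrow together with its two endpoints: an object of the category `D₁`. -/
structure Loose {D : Type u} (Pro : D → D → Type w) where
  {dom : D}
  {cod : D}
  pro : Pro dom cod


/-- The two categories `D₀` (objects and arrows) and `D₁` (proarrows and cells) of a double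
category, with the source and target functors `D₁ ⇉ D₀`. -/
class PreDoubleCategory (D : Type u) extends Category.{v} D where
  /-- the proarrows -/
  Pro : D → D → Type w
  /-- the category `D₁`; its morphisms are the cells -/
  cellCategory : Category.{t} (Loose Pro)
  src : ∀ {P Q : Loose Pro}, (P ⟶ Q) → (P.dom ⟶ Q.dom)
  tgt : ∀ {P Q : Loose Pro}, (P ⟶ Q) → (P.cod ⟶ Q.cod)
  src_id : ∀ P : Loose Pro, src (𝟙 P) = 𝟙 P.dom
  tgt_id : ∀ P : Loose Pro, tgt (𝟙 P) = 𝟙 P.cod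
  src_comp : ∀ {P Q R : Loose Pro} (α : P ⟶ Q) (β : Q ⟶ R), src (α ≫ β) = src α ≫ src β
  tgt_comp : ∀ {P Q R : Loose Pro} (α : P ⟶ Q) (β : Q ⟶ R), tgt (α ≫ β) = tgt α ≫ tgt β

open PreDoubleCategory

/-- `x ⇸ y` is the type of proarrows from `x` to `y`. -/
infix:26 " ⇸ " => PreDoubleCategory.Pro

attribute [reducible, instance] PreDoubleCategory.cellCategory
attribute [simp] src_id tgt_id src_comp tgt_comp

/-- Cells with top `m` and bottom `n`.  The left and right boundary arrows of a cell `α` are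
`src α` and `tgt α`; internal (vertical) composition of cells is `≫`. -/
abbrev Cell {D : Type u} [PreDoubleCategory.{t, w, v} D] {x y x' y' : D}
    (m : x ⇸ y) (n : x' ⇸ y') : Type t :=
  (Loose.mk m : Loose (D := D) Pro) ⟶ Loose.mk n

/-- Globular cells: both boundary arrows are identities. -/
@[ext]
structure Glob {D : Type u} [PreDoubleCategory.{t, w, v} D] {x y : D} (m n : x ⇸ y) :
    Type t where
  cell : Cell m n
  src_cell : src cell = 𝟙 x
  tgt_cell : tgt cell = 𝟙 y

attribute [simp] Glob.src_cell Glob.tgt_cell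

/-- Proarrows `x ⇸ y` and globular cells form a category, written `m ⟶ n`.  A globular cell is
invertible here exactly if it is invertible in `D₁`. -/
instance globCategory {D : Type u} [PreDoubleCategory.{t, w, v} D] (x y : D) :
    Category.{t} (x ⇸ y) where
  Hom m n := Glob m n
  id m := ⟨𝟙 (Loose.mk m), src_id _, tgt_id _⟩
  comp α β := ⟨α.cell ≫ β.cell, by simp, by simp⟩
  id_comp α := Glob.ext (Category.id_comp _)
  comp_id α := Glob.ext (Category.comp_id _)
  assoc α β γ := Glob.ext (Category.assoc _ _ _)

section
variable {D : Type u} [PreDoubleCategory.{t, w, v} D] {x y : D}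

@[ext]
theorem glob_ext {m n : x ⇸ y} {α β : m ⟶ n} (h : α.cell = β.cell) : α = β := Glob.ext h

@[simp]
theorem glob_id_cell (m : x ⇸ y) : Glob.cell (𝟙 m) = 𝟙 (Loose.mk m) := rfl

@[simp]
theorem glob_comp_cell {m n p : x ⇸ y} (α : m ⟶ n) (β : n ⟶ p) :
    Glob.cell (α ≫ β) = Glob.cell α ≫ Glob.cell β := rfl

theorem frame_id_id {z : D} (m : x ⇸ y) (n : y ⇸ z) :
    tgt (𝟙 (Loose.mk m)) = src (𝟙 (Loose.mk n)) := by simp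

theorem frame_id_glob {z : D} (m : x ⇸ y) {n n' : y ⇸ z} (β : n ⟶ n') :
    tgt (𝟙 (Loose.mk m)) = src β.cell := by simp

theorem frame_glob_id {z : D} {m m' : x ⇸ y} (α : m ⟶ m') (n : y ⇸ z) :
    tgt α.cell = src (𝟙 (Loose.mk n)) := by simp

theorem frame_comp {x y z x' y' z' x'' y'' z'' : D} {m : x ⇸ y} {n : y ⇸ z}
    {m' : x' ⇸ y'} {n' : y' ⇸ z'} {m'' : x'' ⇸ y''} {n'' : y'' ⇸ z''}
    (α : Cell m m') (β : Cell n n') (α' : Cell m' m'') (β' : Cell n' n'')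
    (h : tgt α = src β) (h' : tgt α' = src β') : tgt (α ≫ α') = src (β ≫ β') := by
  simp [h, h']

end

/-- A (pseudo) double category: a pair `D₁ ⇉ D₀` with external identities and external
composition that are functorial, and that are associative and unital up to coherent globular
isomorphism. -/
class DoubleCategory (D : Type u) extends PreDoubleCategory.{t, w, v} D where
  /-- external identities -/
  hid : ∀ x : D, x ⇸ x
  hidMap : ∀ {x y : D}, (x ⟶ y) → Cell (hid x) (hid y)
  src_hidMap : ∀ {x y : D} (f : x ⟶ y), src (hidMap f) = f
  tgt_hidMap : ∀ {x y : D} (f : x ⟶ y), tgt (hidMap f) = f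
  hidMap_id : ∀ x : D, hidMap (𝟙 x) = 𝟙 (Loose.mk (hid x))
  hidMap_comp : ∀ {x y z : D} (f : x ⟶ y) (g : y ⟶ z), hidMap (f ≫ g) = hidMap f ≫ hidMap g
  /-- external composition of proarrows -/
  hcomp : ∀ {x y z : D}, x ⇸ y → y ⇸ z → x ⇸ z
  /-- external composition of cells with a common boundary arrow -/
  hcompMap : ∀ {x y z x' y' z' : D} {m : x ⇸ y} {n : y ⇸ z} {m' : x' ⇸ y'} {n' : y' ⇸ z'}
    (α : Cell m m') (β : Cell n n'), tgt α = src β → Cell (hcomp m n) (hcomp m' n')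
  src_hcompMap : ∀ {x y z x' y' z' : D} {m : x ⇸ y} {n : y ⇸ z} {m' : x' ⇸ y'}
    {n' : y' ⇸ z'} (α : Cell m m') (β : Cell n n') (h : tgt α = src β),
    src (hcompMap α β h) = src α
  tgt_hcompMap : ∀ {x y z x' y' z' : D} {m : x ⇸ y} {n : y ⇸ z} {m' : x' ⇸ y'}
    {n' : y' ⇸ z'} (α : Cell m m') (β : Cell n n') (h : tgt α = src β),
    tgt (hcompMap α β h) = tgt β
  hcompMap_id : ∀ {x y z : D} (m : x ⇸ y) (n : y ⇸ z),
    hcompMap (𝟙 (Loose.mk m)) (𝟙 (Loose.mk n)) (frame_id_id m n) = 𝟙 (Loose.mk (hcomp m n))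
  hcompMap_comp : ∀ {x y z x' y' z' x'' y'' z'' : D} {m : x ⇸ y} {n : y ⇸ z}
    {m' : x' ⇸ y'} {n' : y' ⇸ z'} {m'' : x'' ⇸ y''} {n'' : y'' ⇸ z''}
    (α : Cell m m') (β : Cell n n') (α' : Cell m' m'') (β' : Cell n' n'')
    (h : tgt α = src β) (h' : tgt α' = src β'),
    hcompMap (α ≫ α') (β ≫ β') (frame_comp α β α' β' h h') = hcompMap α β h ≫ hcompMap α' β' h'
  /-- associators and unitors, natural globular isomorphisms -/
  hassoc : ∀ {x y z s : D} (m : x ⇸ y) (n : y ⇸ z) (p : z ⇸ s),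
    hcomp (hcomp m n) p ≅ hcomp m (hcomp n p)
  hassoc_naturality : ∀ {x y z s x' y' z' s' : D} {m : x ⇸ y} {n : y ⇸ z} {p : z ⇸ s}
    {m' : x' ⇸ y'} {n' : y' ⇸ z'} {p' : z' ⇸ s'}
    (α : Cell m m') (β : Cell n n') (γ : Cell p p') (h : tgt α = src β) (h' : tgt β = src γ),
    hcompMap (hcompMap α β h) γ ((tgt_hcompMap α β h).trans h') ≫ (hassoc m' n' p').hom.cell =
      (hassoc m n p).hom.cell ≫ hcompMap α (hcompMap β γ h') (h.trans (src_hcompMap β γ h').symm)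
  leftUnitor : ∀ {x y : D} (m : x ⇸ y), hcomp (hid x) m ≅ m
  leftUnitor_naturality : ∀ {x y x' y' : D} {m : x ⇸ y} {n : x' ⇸ y'} (α : Cell m n),
    hcompMap (hidMap (src α)) α (tgt_hidMap _) ≫ (leftUnitor n).hom.cell =
      (leftUnitor m).hom.cell ≫ α
  rightUnitor : ∀ {x y : D} (m : x ⇸ y), hcomp m (hid y) ≅ m
  rightUnitor_naturality : ∀ {x y x' y' : D} {m : x ⇸ y} {n : x' ⇸ y'} (α : Cell m n),
    hcompMap α (hidMap (tgt α)) (src_hidMap _).symm ≫ (rightUnitor n).hom.cell =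
      (rightUnitor m).hom.cell ≫ α
  pentagon : ∀ {x y z s r : D} (m : x ⇸ y) (n : y ⇸ z) (p : z ⇸ s) (q : s ⇸ r),
    hcompMap (hassoc m n p).hom.cell (𝟙 (Loose.mk q)) (frame_glob_id _ q) ≫
        (hassoc m (hcomp n p) q).hom.cell ≫
          hcompMap (𝟙 (Loose.mk m)) (hassoc n p q).hom.cell (frame_id_glob m _) =
      (hassoc (hcomp m n) p q).hom.cell ≫ (hassoc m n (hcomp p q)).hom.cell
  triangle : ∀ {x y z : D} (m : x ⇸ y) (n : y ⇸ z),
    (hassoc m (hid y) n).hom.cell ≫ hcompMap (𝟙 (Loose.mk m)) (leftUnitor n).hom.cell (frame_id_glob m _) =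
      hcompMap (rightUnitor m).hom.cell (𝟙 (Loose.mk n)) (frame_glob_id _ n)

open DoubleCategory

attribute [simp] src_hidMap tgt_hidMap src_hcompMap tgt_hcompMap

/-- External composition, written in diagrammatic order. -/
infixl:70 " ⊙ " => DoubleCategory.hcomp

section
variable {D : Type u} [DoubleCategory.{t, w, v} D]

/-- Whiskering of a globular cell by a proarrow on the left, `1_m ⊙ β`. -/
def whiskerL {x y z : D} (m : x ⇸ y) {n n' : y ⇸ z} (β : n ⟶ n') : m ⊙ n ⟶ m ⊙ n' :=
  ⟨hcompMap (𝟙 (Loose.mk m)) β.cell (frame_id_glob m β), by simp, by simp⟩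

/-- Whiskering of a globular cell by a proarrow on the right, `α ⊙ 1_n`. -/
def whiskerR {x y z : D} {m m' : x ⇸ y} (α : m ⟶ m') (n : y ⇸ z) : m ⊙ n ⟶ m' ⊙ n :=
  ⟨hcompMap α.cell (𝟙 (Loose.mk n)) (frame_glob_id α n), by simp, by simp⟩

infixr:81 " ◁ₚ " => whiskerL
infixl:81 " ▷ₚ " => whiskerR

theorem hcompMap_congr {x y z x' y' z' : D} {m : x ⇸ y} {n : y ⇸ z} {m' : x' ⇸ y'}
    {n' : y' ⇸ z'} {α α' : Cell m m'} {β β' : Cell n n'} {h : tgt α = src β}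
    (hα : α = α') (hβ : β = β') :
    hcompMap α β h = hcompMap α' β' (by rw [← hα, ← hβ, h]) := by
  subst hα hβ; rfl

theorem whiskerL_id {x y z : D} (m : x ⇸ y) (n : y ⇸ z) : m ◁ₚ 𝟙 n = 𝟙 (m ⊙ n) :=
  glob_ext (hcompMap_id _ _)

theorem id_whiskerR {x y z : D} (m : x ⇸ y) (n : y ⇸ z) : 𝟙 m ▷ₚ n = 𝟙 (m ⊙ n) :=
  glob_ext (hcompMap_id _ _)

theorem whiskerL_comp {x y z : D} (m : x ⇸ y) {n n' n'' : y ⇸ z} (β : n ⟶ n')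
    (γ : n' ⟶ n'') : m ◁ₚ (β ≫ γ) = m ◁ₚ β ≫ m ◁ₚ γ := by
  apply glob_ext
  refine Eq.trans ?_ (hcompMap_comp _ _ _ _ _ _)
  exact hcompMap_congr (Category.comp_id _).symm rfl

theorem comp_whiskerR {x y z : D} {m m' m'' : x ⇸ y} (α : m ⟶ m') (β : m' ⟶ m'')
    (n : y ⇸ z) : (α ≫ β) ▷ₚ n = α ▷ₚ n ≫ β ▷ₚ n := by
  apply glob_ext
  refine Eq.trans ?_ (hcompMap_comp _ _ _ _ _ _)
  exact hcompMap_congr rfl (Category.comp_id _).symm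

theorem id_whiskerL {x y : D} {m n : x ⇸ y} (α : m ⟶ n) :
    hid x ◁ₚ α = (leftUnitor m).hom ≫ α ≫ (leftUnitor n).inv := by
  rw [← Category.assoc, Iso.eq_comp_inv]
  ext
  have := leftUnitor_naturality (α.cell)
  simp only [glob_comp_cell, ← this, whiskerL]
  congr 1
  exact hcompMap_congr (by simp [hidMap_id]) rfl

theorem whiskerR_id {x y : D} {m n : x ⇸ y} (α : m ⟶ n) :
    α ▷ₚ hid y = (rightUnitor m).hom ≫ α ≫ (rightUnitor n).inv := by
  rw [← Category.assoc, Iso.eq_comp_inv]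
  ext
  have := rightUnitor_naturality (α.cell)
  simp only [glob_comp_cell, ← this, whiskerR]
  congr 1
  exact hcompMap_congr rfl (by simp [hidMap_id])

theorem comp_whiskerL {x y z s : D} (m : x ⇸ y) (n : y ⇸ z) {p p' : z ⇸ s} (β : p ⟶ p') :
    (m ⊙ n) ◁ₚ β = (hassoc m n p).hom ≫ m ◁ₚ n ◁ₚ β ≫ (hassoc m n p').inv := by
  rw [← Category.assoc, Iso.eq_comp_inv]
  apply glob_ext
  refine Eq.trans ?_ (hassoc_naturality _ _ _ (frame_id_id _ _) (frame_id_glob _ _))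
  exact congrArg (· ≫ _) (hcompMap_congr (hcompMap_id _ _).symm rfl)

theorem whiskerR_comp {x y z s : D} {m m' : x ⇸ y} (α : m ⟶ m') (n : y ⇸ z) (p : z ⇸ s) :
    α ▷ₚ (n ⊙ p) = (hassoc m n p).inv ≫ α ▷ₚ n ▷ₚ p ≫ (hassoc m' n p).hom := by
  rw [Iso.eq_inv_comp]
  apply glob_ext
  refine Eq.trans ?_ (hassoc_naturality _ _ _ (frame_glob_id _ _) (frame_id_id _ _)).symm
  exact congrArg (_ ≫ ·) (hcompMap_congr rfl (hcompMap_id _ _).symm)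

theorem whisker_assoc {x y z s : D} (m : x ⇸ y) {n n' : y ⇸ z} (β : n ⟶ n') (p : z ⇸ s) :
    (m ◁ₚ β) ▷ₚ p = (hassoc m n p).hom ≫ m ◁ₚ β ▷ₚ p ≫ (hassoc m n' p).inv := by
  rw [← Category.assoc, Iso.eq_comp_inv]
  apply glob_ext
  exact hassoc_naturality _ _ _ (frame_id_glob _ _) (frame_glob_id _ _)

theorem whisker_exchange {x y z : D} {m m' : x ⇸ y} {n n' : y ⇸ z} (α : m ⟶ m')
    (β : n ⟶ n') : m ◁ₚ β ≫ α ▷ₚ n' = α ▷ₚ n ≫ m' ◁ₚ β := by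
  apply glob_ext
  refine (hcompMap_comp _ _ _ _ _ _).symm.trans (Eq.trans ?_ (hcompMap_comp _ _ _ _ _ _))
  exact hcompMap_congr (by simp) (by simp)

/-- The type of objects of `D`, regarded as the objects of its underlying bicategory. -/
def UBicat (D : Type u) : Type u := D

/-- The underlying bicategory of a double category: objects, proarrows and globular cells. -/
instance : Bicategory.{t, w} (UBicat D) where
  Hom x y := PreDoubleCategory.Pro (D := D) x y
  id x := hid (D := D) x
  comp m n := hcomp (D := D) m n
  homCategory x y := globCategory (D := D) x y
  whiskerLeft m _ _ β := whiskerL (D := D) m β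
  whiskerRight α n := whiskerR (D := D) α n
  associator m n p := DoubleCategory.hassoc (D := D) m n p
  leftUnitor m := DoubleCategory.leftUnitor (D := D) m
  rightUnitor m := DoubleCategory.rightUnitor (D := D) m
  whiskerLeft_id m n := whiskerL_id (D := D) m n
  whiskerLeft_comp m _ _ _ β γ := whiskerL_comp (D := D) m β γ
  id_whiskerLeft β := id_whiskerL (D := D) β
  comp_whiskerLeft m n _ _ β := comp_whiskerL (D := D) m n β
  id_whiskerRight m n := id_whiskerR (D := D) m n
  comp_whiskerRight β γ n := comp_whiskerR (D := D) β γ n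
  whiskerRight_id β := whiskerR_id (D := D) β
  whiskerRight_comp β n p := whiskerR_comp (D := D) β n p
  whisker_assoc m _ _ β p := whisker_assoc (D := D) m β p
  whisker_exchange α β := whisker_exchange (D := D) α β
  pentagon _ _ _ _ := glob_ext (D := D) (DoubleCategory.pentagon _ _ _ _)
  triangle _ _ := glob_ext (D := D) (DoubleCategory.triangle _ _)

instance isIso_whiskerL {x y z : D} (m : x ⇸ y) {n n' : y ⇸ z} (β : n ⟶ n') [IsIso β] :
    IsIso (m ◁ₚ β) :=
  ⟨m ◁ₚ inv β, by rw [← whiskerL_comp, IsIso.hom_inv_id, whiskerL_id],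
    by rw [← whiskerL_comp, IsIso.inv_hom_id, whiskerL_id]⟩

instance isIso_whiskerR {x y z : D} {m m' : x ⇸ y} (α : m ⟶ m') [IsIso α] (n : y ⇸ z) :
    IsIso (α ▷ₚ n) :=
  ⟨inv α ▷ₚ n, by rw [← comp_whiskerR, IsIso.hom_inv_id, id_whiskerR],
    by rw [← comp_whiskerR, IsIso.inv_hom_id, id_whiskerR]⟩

end

/-! ### Companions, conjoints, commuters -/

section
variable {D : Type u} [DoubleCategory.{t, w, v} D]

/-- A companion of the arrow `f`: a proarrow `f_! : x ⇸ y` with unit and counit cells. -/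
structure Companion {x y : D} (f : x ⟶ y) where
  pro : x ⇸ y
  unit : Cell (hid x) pro
  src_unit : src unit = 𝟙 x
  tgt_unit : tgt unit = f
  counit : Cell pro (hid y)
  src_counit : src counit = f
  tgt_counit : tgt counit = 𝟙 y
  /-- `η ⊙ ε = 1`, up to the unit isomorphisms -/
  unit_hcomp_counit :
    (leftUnitor pro).inv.cell ≫ hcompMap unit counit (tgt_unit.trans src_counit.symm) ≫
      (rightUnitor pro).hom.cell = 𝟙 (Loose.mk pro)
  /-- `η ⬝ ε = id_f` -/
  unit_comp_counit : unit ≫ counit = hidMap f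

/-- A conjoint of the arrow `f`: a proarrow `f^* : y ⇸ x` with unit and counit cells. -/
structure Conjoint {x y : D} (f : x ⟶ y) where
  pro : y ⇸ x
  unit : Cell (hid x) pro
  src_unit : src unit = f
  tgt_unit : tgt unit = 𝟙 x
  counit : Cell pro (hid y)
  src_counit : src counit = 𝟙 y
  tgt_counit : tgt counit = f
  /-- `ε ⊙ η = 1`, up to the unit isomorphisms -/
  counit_hcomp_unit :
    (rightUnitor pro).inv.cell ≫ hcompMap counit unit (tgt_counit.trans src_unit.symm) ≫
      (leftUnitor pro).hom.cell = 𝟙 (Loose.mk pro)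
  /-- `η ⬝ ε = id_f` -/
  unit_comp_counit : unit ≫ counit = hidMap f

def HasCompanion {x y : D} (f : x ⟶ y) : Prop := Nonempty (Companion f)

def HasConjoint {x y : D} (f : x ⟶ y) : Prop := Nonempty (Conjoint f)

/-- The globular cell `α_! : m ⊙ g_! ⟶ f_! ⊙ n` obtained by sliding the boundary arrows
`f`, `g` of a cell `α` along companions: the external composite `η_f ⊙ α ⊙ ε_g`. -/
def slideCompanion {x y x' y' : D} {m : x ⇸ y} {n : x' ⇸ y'} {f : x ⟶ x'} {g : y ⟶ y'}
    (cf : Companion f) (cg : Companion g) (α : Cell m n) (hf : src α = f) (hg : tgt α = g) :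
    m ⊙ cg.pro ⟶ cf.pro ⊙ n :=
  (leftUnitor m).inv ▷ₚ cg.pro ≫
    (⟨hcompMap (hcompMap cf.unit α (cf.tgt_unit.trans hf.symm)) cg.counit
        ((tgt_hcompMap _ _ _).trans (hg.trans cg.src_counit.symm)),
      by rw [src_hcompMap, src_hcompMap, cf.src_unit],
      by rw [tgt_hcompMap, cg.tgt_counit]⟩ :
      hid x ⊙ m ⊙ cg.pro ⟶ cf.pro ⊙ n ⊙ hid y') ≫
    (rightUnitor (cf.pro ⊙ n)).hom

/-- The globular cell `α^* : f^* ⊙ m ⟶ n ⊙ g^*` obtained by sliding the boundary arrows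
`f`, `g` of a cell `α` along conjoints: the external composite `ε_f ⊙ α ⊙ η_g`. -/
def slideConjoint {x y x' y' : D} {m : x ⇸ y} {n : x' ⇸ y'} {f : x ⟶ x'} {g : y ⟶ y'}
    (cf : Conjoint f) (cg : Conjoint g) (α : Cell m n) (hf : src α = f) (hg : tgt α = g) :
    cf.pro ⊙ m ⟶ n ⊙ cg.pro :=
  cf.pro ◁ₚ (rightUnitor m).inv ≫
    (⟨hcompMap cf.counit (hcompMap α cg.unit (hg.trans cg.src_unit.symm))
        ((cf.tgt_counit.trans hf.symm).trans (src_hcompMap _ _ _).symm),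
      by rw [src_hcompMap, cf.src_counit],
      by rw [tgt_hcompMap, tgt_hcompMap, cg.tgt_unit]⟩ :
      cf.pro ⊙ (m ⊙ hid y) ⟶ hid x' ⊙ (n ⊙ cg.pro)) ≫
    (leftUnitor (n ⊙ cg.pro)).hom

/-- A cell is a commuter if its boundary arrows have companions and `α_!` is an isomorphism
(for any choice of companions). -/
def IsCommuter {x y x' y' : D} {m : x ⇸ y} {n : x' ⇸ y'} (α : Cell m n) : Prop :=
  HasCompanion (src α) ∧ HasCompanion (tgt α) ∧
    ∀ (cf : Companion (src α)) (cg : Companion (tgt α)),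
      IsIso (slideCompanion cf cg α rfl rfl)

/-- A cell is a cocommuter if its boundary arrows have conjoints and `α^*` is an isomorphism
(for any choice of conjoints). -/
def IsCocommuter {x y x' y' : D} {m : x ⇸ y} {n : x' ⇸ y'} (α : Cell m n) : Prop :=
  HasConjoint (src α) ∧ HasConjoint (tgt α) ∧
    ∀ (cf : Conjoint (src α)) (cg : Conjoint (tgt α)),
      IsIso (slideConjoint cf cg α rfl rfl)

end

/-! ### Lax double functors, transformations, protransformations, modifications -/

section
variable (D : Type u₁) [DoubleCategory.{t₁, w₁, v₁} D]
variable (E : Type u₂) [DoubleCategory.{t₂, w₂, v₂} E]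

/-- A lax double functor: functors on `D₀` and `D₁` compatible with sources and targets,
with natural, coherent globular comparison cells `F_{m,n}` and `F_x`. -/
structure LaxDoubleFunctor extends D ⥤ E where
  mapPro : ∀ {x y : D}, (x ⇸ y) → (obj x ⇸ obj y)
  mapCell : ∀ {x y x' y' : D} {m : x ⇸ y} {n : x' ⇸ y'},
    Cell m n → Cell (mapPro m) (mapPro n)
  src_mapCell : ∀ {x y x' y' : D} {m : x ⇸ y} {n : x' ⇸ y'} (α : Cell m n),
    src (mapCell α) = map (src α)
  tgt_mapCell : ∀ {x y x' y' : D} {m : x ⇸ y} {n : x' ⇸ y'} (α : Cell m n),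
    tgt (mapCell α) = map (tgt α)
  mapCell_id : ∀ {x y : D} (m : x ⇸ y), mapCell (𝟙 (Loose.mk m)) = 𝟙 (Loose.mk (mapPro m))
  mapCell_comp : ∀ {x y x' y' x'' y'' : D} {m : x ⇸ y} {n : x' ⇸ y'} {p : x'' ⇸ y''}
    (α : Cell m n) (β : Cell n p), mapCell (α ≫ β) = mapCell α ≫ mapCell β
  /-- the laxator `F_{m,n}` -/
  laxComp : ∀ {x y z : D} (m : x ⇸ y) (n : y ⇸ z), mapPro m ⊙ mapPro n ⟶ mapPro (m ⊙ n)
  /-- the laxator `F_x` -/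
  laxId : ∀ x : D, hid (obj x) ⟶ mapPro (hid x)
  laxComp_naturality : ∀ {x y z x' y' z' : D} {m : x ⇸ y} {n : y ⇸ z} {m' : x' ⇸ y'}
    {n' : y' ⇸ z'} (α : Cell m m') (β : Cell n n') (h : tgt α = src β),
    hcompMap (mapCell α) (mapCell β) (by rw [tgt_mapCell, src_mapCell, h]) ≫
        (laxComp m' n').cell =
      (laxComp m n).cell ≫ mapCell (hcompMap α β h)
  laxId_naturality : ∀ {x y : D} (f : x ⟶ y),
    hidMap (map f) ≫ (laxId y).cell = (laxId x).cell ≫ mapCell (hidMap f)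
  laxComp_hassoc : ∀ {x y z s : D} (m : x ⇸ y) (n : y ⇸ z) (p : z ⇸ s),
    (laxComp m n ▷ₚ mapPro p ≫ laxComp (m ⊙ n) p).cell ≫ mapCell (hassoc m n p).hom.cell =
      ((hassoc _ _ _).hom ≫ mapPro m ◁ₚ laxComp n p ≫ laxComp m (n ⊙ p)).cell
  laxComp_leftUnitor : ∀ {x y : D} (m : x ⇸ y),
    (laxId x ▷ₚ mapPro m ≫ laxComp (hid x) m).cell ≫ mapCell (leftUnitor m).hom.cell =
      (leftUnitor (mapPro m)).hom.cell
  laxComp_rightUnitor : ∀ {x y : D} (m : x ⇸ y),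
    (mapPro m ◁ₚ laxId y ≫ laxComp m (hid y)).cell ≫ mapCell (rightUnitor m).hom.cell =
      (rightUnitor (mapPro m)).hom.cell

end

section
variable {D : Type u₁} [DoubleCategory.{t₁, w₁, v₁} D]
variable {E : Type u₂} [DoubleCategory.{t₂, w₂, v₂} E]

attribute [simp] LaxDoubleFunctor.src_mapCell LaxDoubleFunctor.tgt_mapCell

/-- A (tight, strict) natural transformation between lax double functors. -/
structure NatTransf (F G : LaxDoubleFunctor D E) where
  app : ∀ x : D, F.obj x ⟶ G.obj x
  naturality : ∀ {x y : D} (f : x ⟶ y), F.map f ≫ app y = app x ≫ G.map f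
  /-- the component `α_m` at a proarrow `m` -/
  cell : ∀ {x y : D} (m : x ⇸ y), Cell (F.mapPro m) (G.mapPro m)
  src_cell : ∀ {x y : D} (m : x ⇸ y), src (cell m) = app x
  tgt_cell : ∀ {x y : D} (m : x ⇸ y), tgt (cell m) = app y
  cell_naturality : ∀ {x y x' y' : D} {m : x ⇸ y} {n : x' ⇸ y'} (γ : Cell m n),
    F.mapCell γ ≫ cell n = cell m ≫ G.mapCell γ
  cell_hcomp : ∀ {x y z : D} (m : x ⇸ y) (n : y ⇸ z),
    (F.laxComp m n).cell ≫ cell (m ⊙ n) =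
      hcompMap (cell m) (cell n) (by rw [tgt_cell, src_cell]) ≫ (G.laxComp m n).cell
  cell_hid : ∀ x : D,
    (F.laxId x).cell ≫ cell (hid x) = hidMap (app x) ≫ (G.laxId x).cell

attribute [simp] NatTransf.src_cell NatTransf.tgt_cell

theorem NatTransf.ext' {F G : LaxDoubleFunctor D E} {α β : NatTransf F G}
    (happ : ∀ x, α.app x = β.app x) (hcell : ∀ {x y : D} (m : x ⇸ y), α.cell m = β.cell m) :
    α = β := by
  cases α; cases β
  congr
  · exact funext happ
  · funext x y m; exact hcell m

/-- Lax double functors `D → E` and natural transformations form a category. -/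
instance : Category.{max u₁ w₁ v₂ t₂} (LaxDoubleFunctor D E) where
  Hom F G := NatTransf F G
  id F :=
    { app := fun x => 𝟙 (F.obj x)
      naturality := by simp
      cell := fun m => 𝟙 (Loose.mk (F.mapPro m))
      src_cell := by simp
      tgt_cell := by simp
      cell_naturality := fun γ => by rw [Category.comp_id, Category.id_comp]
      cell_hcomp := fun m n => by rw [hcompMap_id, Category.comp_id, Category.id_comp]
      cell_hid := fun x => by rw [hidMap_id, Category.comp_id, Category.id_comp] }
  comp {F G H} α β :=
    { app := fun x => α.app x ≫ β.app x
      naturality := fun f => by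
        rw [← Category.assoc, α.naturality, Category.assoc, β.naturality, Category.assoc]
      cell := fun m => α.cell m ≫ β.cell m
      src_cell := by simp
      tgt_cell := by simp
      cell_naturality := fun γ => by
        rw [← Category.assoc, α.cell_naturality, Category.assoc, β.cell_naturality,
          Category.assoc]
      cell_hcomp := fun m n => by
        rw [← Category.assoc, α.cell_hcomp, Category.assoc, β.cell_hcomp, ← Category.assoc,
          hcompMap_comp]
      cell_hid := fun x => by
        rw [← Category.assoc, α.cell_hid, Category.assoc, β.cell_hid, ← Category.assoc,
          hidMap_comp] }
  id_comp α := NatTransf.ext' (fun _ => Category.id_comp _) (fun _ => Category.id_comp _)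
  comp_id α := NatTransf.ext' (fun _ => Category.comp_id _) (fun _ => Category.comp_id _)
  assoc α β γ :=
    NatTransf.ext' (fun _ => Category.assoc _ _ _) (fun _ => Category.assoc _ _ _)

/-- A lax protransformation `F ⇸ G`. -/
structure LaxProtransf (F G : LaxDoubleFunctor D E) where
  pro : ∀ x : D, F.obj x ⇸ G.obj x
  /-- the component at an arrow -/
  arr : ∀ {x y : D}, (x ⟶ y) → Cell (pro x) (pro y)
  src_arr : ∀ {x y : D} (f : x ⟶ y), src (arr f) = F.map f
  tgt_arr : ∀ {x y : D} (f : x ⟶ y), tgt (arr f) = G.map f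
  /-- the naturality comparison at a proarrow -/
  comparison : ∀ {x y : D} (m : x ⇸ y), pro x ⊙ G.mapPro m ⟶ F.mapPro m ⊙ pro y
  arr_id : ∀ x : D, arr (𝟙 x) = 𝟙 (Loose.mk (pro x))
  arr_comp : ∀ {x y z : D} (f : x ⟶ y) (g : y ⟶ z), arr (f ≫ g) = arr f ≫ arr g
  naturality : ∀ {x y x' y' : D} {m : x ⇸ y} {n : x' ⇸ y'} (γ : Cell m n),
    (comparison m).cell ≫
        hcompMap (F.mapCell γ) (arr (tgt γ)) (by rw [F.tgt_mapCell, src_arr]) =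
      hcompMap (arr (src γ)) (G.mapCell γ) (by rw [G.src_mapCell, tgt_arr]) ≫
        (comparison n).cell
  comparison_hcomp : ∀ {x y z : D} (m : x ⇸ y) (n : y ⇸ z),
    pro x ◁ₚ G.laxComp m n ≫ comparison (m ⊙ n) =
      (hassoc _ _ _).inv ≫ comparison m ▷ₚ G.mapPro n ≫ (hassoc _ _ _).hom ≫
        F.mapPro m ◁ₚ comparison n ≫ (hassoc _ _ _).inv ≫ F.laxComp m n ▷ₚ pro z
  comparison_hid : ∀ x : D,
    pro x ◁ₚ G.laxId x ≫ comparison (hid x) =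
      (rightUnitor _).hom ≫ (leftUnitor _).inv ≫ F.laxId x ▷ₚ pro x

attribute [simp] LaxProtransf.src_arr LaxProtransf.tgt_arr

/-- A pseudo protransformation `F ⇸ G`: all naturality comparisons are invertible. -/
structure PseudoProtransf (F G : LaxDoubleFunctor D E) extends LaxProtransf F G where
  isIso_comparison : ∀ {x y : D} (m : x ⇸ y), IsIso (comparison m)

attribute [instance] PseudoProtransf.isIso_comparison

/-- A modification (a cell of transformations) with top `σ` and bottom `τ`; its left and right boundary natural
transformations are part of the data. -/
structure Modif {F G H K : LaxDoubleFunctor D E} (σ : LaxProtransf F G)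
    (τ : LaxProtransf H K) where
  left : F ⟶ H
  right : G ⟶ K
  app : ∀ x : D, Cell (σ.pro x) (τ.pro x)
  src_app : ∀ x : D, src (app x) = left.app x
  tgt_app : ∀ x : D, tgt (app x) = right.app x
  arr_equivariance : ∀ {x y : D} (f : x ⟶ y), app x ≫ τ.arr f = σ.arr f ≫ app y
  pro_equivariance : ∀ {x y : D} (m : x ⇸ y),
    hcompMap (app x) (right.cell m) (by rw [tgt_app, right.src_cell]) ≫
        (τ.comparison m).cell =
      (σ.comparison m).cell ≫
        hcompMap (left.cell m) (app y) (by rw [src_app, left.tgt_cell])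

attribute [simp] Modif.src_app Modif.tgt_app

@[ext]
theorem Modif.ext' {F G H K : LaxDoubleFunctor D E} {σ : LaxProtransf F G}
    {τ : LaxProtransf H K} {μ ν : Modif σ τ} (hl : μ.left = ν.left) (hr : μ.right = ν.right)
    (happ : ∀ x, μ.app x = ν.app x) : μ = ν := by
  cases μ; cases ν
  cases hl; cases hr
  congr
  exact funext happ

end

/-! ### The double category of pseudo protransformations -/

section
variable {E : Type u} [DoubleCategory.{t, w, v} E]

/-- Composite of two naturality comparisons. -/
def compCmp {a₀ a₁ b₀ b₁ c₀ c₁ : E} {f : a₀ ⇸ a₁} {g : b₀ ⇸ b₁} {h : c₀ ⇸ c₁}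
    {s₀ : a₀ ⇸ b₀} {s₁ : a₁ ⇸ b₁} {t₀ : b₀ ⇸ c₀} {t₁ : b₁ ⇸ c₁}
    (σ : s₀ ⊙ g ⟶ f ⊙ s₁) (τ : t₀ ⊙ h ⟶ g ⊙ t₁) : s₀ ⊙ t₀ ⊙ h ⟶ f ⊙ (s₁ ⊙ t₁) :=
  (hassoc _ _ _).hom ≫ s₀ ◁ₚ τ ≫ (hassoc _ _ _).inv ≫ σ ▷ₚ t₁ ≫ (hassoc _ _ _).hom

/-- Naturality comparison of the identity protransformation. -/
def idCmp {a₀ a₁ : E} (f : a₀ ⇸ a₁) : hid a₀ ⊙ f ⟶ f ⊙ hid a₁ :=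
  (leftUnitor f).hom ≫ (rightUnitor f).inv

instance isIso_compCmp {a₀ a₁ b₀ b₁ c₀ c₁ : E} {f : a₀ ⇸ a₁} {g : b₀ ⇸ b₁} {h : c₀ ⇸ c₁}
    {s₀ : a₀ ⇸ b₀} {s₁ : a₁ ⇸ b₁} {t₀ : b₀ ⇸ c₀} {t₁ : b₁ ⇸ c₁}
    (σ : s₀ ⊙ g ⟶ f ⊙ s₁) (τ : t₀ ⊙ h ⟶ g ⊙ t₁) [IsIso σ] [IsIso τ] :
    IsIso (compCmp σ τ) := by
  unfold compCmp; infer_instance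

instance isIso_idCmp {a₀ a₁ : E} (f : a₀ ⇸ a₁) : IsIso (idCmp f) := by
  unfold idCmp; infer_instance

theorem hcompMap_sq {x y z x' y' z' x₁ y₁ z₁ x₂ y₂ z₂ : E}
    {m : x ⇸ y} {n : y ⇸ z} {m' : x' ⇸ y'} {n' : y' ⇸ z'}
    {m₁ : x₁ ⇸ y₁} {n₁ : y₁ ⇸ z₁} {m₂ : x₂ ⇸ y₂} {n₂ : y₂ ⇸ z₂}
    {α : Cell m m'} {β : Cell m' m₂} {α' : Cell m m₁} {β' : Cell m₁ m₂}
    {γ : Cell n n'} {δ : Cell n' n₂} {γ' : Cell n n₁} {δ' : Cell n₁ n₂}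
    (h₁ : tgt α = src γ) (h₂ : tgt β = src δ) (h₃ : tgt α' = src γ') (h₄ : tgt β' = src δ')
    (h : α ≫ β = α' ≫ β') (h' : γ ≫ δ = γ' ≫ δ') :
    hcompMap α γ h₁ ≫ hcompMap β δ h₂ = hcompMap α' γ' h₃ ≫ hcompMap β' δ' h₄ := by
  rw [← hcompMap_comp, ← hcompMap_comp]
  exact hcompMap_congr h h'

theorem inv_sq {x y x' y' : E} {m n : x ⇸ y} {m' n' : x' ⇸ y'} (e : m ≅ n) (e' : m' ≅ n')
    {α : Cell m m'} {β : Cell n n'} (h : α ≫ e'.hom.cell = e.hom.cell ≫ β) :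
    e.inv.cell ≫ α = β ≫ e'.inv.cell := by
  have h₁ : e.inv.cell ≫ e.hom.cell = 𝟙 _ := congrArg Glob.cell e.inv_hom_id
  have h₂ : e'.hom.cell ≫ e'.inv.cell = 𝟙 _ := congrArg Glob.cell e'.hom_inv_id
  calc e.inv.cell ≫ α = e.inv.cell ≫ (α ≫ e'.hom.cell) ≫ e'.inv.cell := by
        rw [Category.assoc, h₂, Category.comp_id]
    _ = (e.inv.cell ≫ e.hom.cell) ≫ β ≫ e'.inv.cell := by
        rw [h]; simp only [Category.assoc]
    _ = _ := by rw [h₁, Category.id_comp]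

theorem compCmp_sq {a₀ a₁ b₀ b₁ c₀ c₁ a₀' a₁' b₀' b₁' c₀' c₁' : E}
    {f : a₀ ⇸ a₁} {g : b₀ ⇸ b₁} {h : c₀ ⇸ c₁}
    {s₀ : a₀ ⇸ b₀} {s₁ : a₁ ⇸ b₁} {t₀ : b₀ ⇸ c₀} {t₁ : b₁ ⇸ c₁}
    {f' : a₀' ⇸ a₁'} {g' : b₀' ⇸ b₁'} {h' : c₀' ⇸ c₁'}
    {s₀' : a₀' ⇸ b₀'} {s₁' : a₁' ⇸ b₁'} {t₀' : b₀' ⇸ c₀'} {t₁' : b₁' ⇸ c₁'}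
    (σ : s₀ ⊙ g ⟶ f ⊙ s₁) (τ : t₀ ⊙ h ⟶ g ⊙ t₁)
    (σ' : s₀' ⊙ g' ⟶ f' ⊙ s₁') (τ' : t₀' ⊙ h' ⟶ g' ⊙ t₁')
    (φ : Cell f f') (γ : Cell g g') (χ : Cell h h')
    (α₀ : Cell s₀ s₀') (α₁ : Cell s₁ s₁') (β₀ : Cell t₀ t₀') (β₁ : Cell t₁ t₁')
    (h₁ : tgt α₀ = src γ) (h₂ : tgt φ = src α₁) (h₃ : tgt β₀ = src χ) (h₄ : tgt γ = src β₁)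
    (h₅ : tgt α₀ = src β₀) (h₆ : tgt α₁ = src β₁)
    (hσ : hcompMap α₀ γ h₁ ≫ σ'.cell = σ.cell ≫ hcompMap φ α₁ h₂)
    (hτ : hcompMap β₀ χ h₃ ≫ τ'.cell = τ.cell ≫ hcompMap γ β₁ h₄) :
    hcompMap (hcompMap α₀ β₀ h₅) χ ((tgt_hcompMap _ _ _).trans h₃) ≫ (compCmp σ' τ').cell =
      (compCmp σ τ).cell ≫
        hcompMap φ (hcompMap α₁ β₁ h₆) (h₂.trans (src_hcompMap _ _ _).symm) := by
  have q₁ := hassoc_naturality α₀ β₀ χ h₅ h₃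
  have q₂ : hcompMap α₀ (hcompMap β₀ χ h₃) (h₅.trans (src_hcompMap _ _ _).symm) ≫
      (s₀' ◁ₚ τ').cell = (s₀ ◁ₚ τ).cell ≫
        hcompMap α₀ (hcompMap γ β₁ h₄) (h₁.trans (src_hcompMap _ _ _).symm) :=
    hcompMap_sq _ _ _ _ (by rw [Category.comp_id, Category.id_comp]) hτ
  have q₃ := inv_sq _ _ (hassoc_naturality α₀ γ β₁ h₁ h₄)
  have q₄ : hcompMap (hcompMap α₀ γ h₁) β₁ ((tgt_hcompMap _ _ _).trans h₄) ≫
      (σ' ▷ₚ t₁').cell = (σ ▷ₚ t₁).cell ≫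
        hcompMap (hcompMap φ α₁ h₂) β₁ ((tgt_hcompMap _ _ _).trans h₆) :=
    hcompMap_sq _ _ _ _ hσ (by rw [Category.comp_id, Category.id_comp])
  have q₅ := hassoc_naturality φ α₁ β₁ h₂ h₆
  have r₁ : CommSq _ _ _ _ := ⟨q₁.symm⟩
  have r₂ : CommSq _ _ _ _ := ⟨q₂.symm⟩
  have r₃ : CommSq _ _ _ _ := ⟨q₃⟩
  have r₄ : CommSq _ _ _ _ := ⟨q₄.symm⟩
  have r₅ : CommSq _ _ _ _ := ⟨q₅.symm⟩
  exact (r₁.horiz_comp (r₂.horiz_comp (r₃.horiz_comp (r₄.horiz_comp r₅)))).w.symm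

theorem idCmp_sq {x y x' y' : E} {m : x ⇸ y} {n : x' ⇸ y'} (α : Cell m n) {f : x ⟶ x'}
    {g : y ⟶ y'} (hf : src α = f) (hg : tgt α = g) :
    hcompMap (hidMap f) α ((tgt_hidMap f).trans hf.symm) ≫ (idCmp n).cell =
      (idCmp m).cell ≫ hcompMap α (hidMap g) (hg.trans (src_hidMap g).symm) := by
  subst hf hg
  have r₁ : CommSq _ _ _ _ := ⟨(leftUnitor_naturality α).symm⟩
  have r₂ : CommSq _ _ _ _ := ⟨inv_sq _ _ (rightUnitor_naturality α)⟩
  exact (r₁.horiz_comp r₂).w.symm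

end

section
open Bicategory
variable {B : Type u} [Bicategory.{w, v} B]

/-- Composite of two comparisons, in a bicategory. -/
abbrev bicatCmp {a₀ a₁ b₀ b₁ c₀ c₁ : B} {f : a₀ ⟶ a₁} {g : b₀ ⟶ b₁} {h : c₀ ⟶ c₁}
    {s₀ : a₀ ⟶ b₀} {s₁ : a₁ ⟶ b₁} {t₀ : b₀ ⟶ c₀} {t₁ : b₁ ⟶ c₁}
    (σ : s₀ ≫ g ⟶ f ≫ s₁) (τ : t₀ ≫ h ⟶ g ≫ t₁) : (s₀ ≫ t₀) ≫ h ⟶ f ≫ (s₁ ≫ t₁) :=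
  (α_ _ _ _).hom ≫ s₀ ◁ τ ≫ (α_ _ _ _).inv ≫ σ ▷ t₁ ≫ (α_ _ _ _).hom

theorem bicat_hcomp {a₀ a₁ a₂ b₀ b₁ b₂ c₀ c₁ c₂ : B}
    {f : a₀ ⟶ a₁} {g : b₀ ⟶ b₁} {h : c₀ ⟶ c₁} {f' : a₁ ⟶ a₂} {g' : b₁ ⟶ b₂} {h' : c₁ ⟶ c₂}
    {f'' : a₀ ⟶ a₂} {g'' : b₀ ⟶ b₂} {h'' : c₀ ⟶ c₂}
    {s₀ : a₀ ⟶ b₀} {s₁ : a₁ ⟶ b₁} {s₂ : a₂ ⟶ b₂}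
    {t₀ : b₀ ⟶ c₀} {t₁ : b₁ ⟶ c₁} {t₂ : b₂ ⟶ c₂}
    (F : f ≫ f' ⟶ f'') (G : g ≫ g' ⟶ g'') (H : h ≫ h' ⟶ h'')
    (σ : s₀ ≫ g ⟶ f ≫ s₁) (σ' : s₁ ≫ g' ⟶ f' ≫ s₂) (σ'' : s₀ ≫ g'' ⟶ f'' ≫ s₂)
    (τ : t₀ ≫ h ⟶ g ≫ t₁) (τ' : t₁ ≫ h' ⟶ g' ≫ t₂) (τ'' : t₀ ≫ h'' ⟶ g'' ≫ t₂)
    (hσ : s₀ ◁ G ≫ σ'' =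
      (α_ _ _ _).inv ≫ σ ▷ g' ≫ (α_ _ _ _).hom ≫ f ◁ σ' ≫ (α_ _ _ _).inv ≫ F ▷ s₂)
    (hτ : t₀ ◁ H ≫ τ'' =
      (α_ _ _ _).inv ≫ τ ▷ h' ≫ (α_ _ _ _).hom ≫ g ◁ τ' ≫ (α_ _ _ _).inv ≫ G ▷ t₂) :
    (s₀ ≫ t₀) ◁ H ≫ bicatCmp σ'' τ'' =
      (α_ _ _ _).inv ≫ bicatCmp σ τ ▷ h' ≫ (α_ _ _ _).hom ≫ f ◁ bicatCmp σ' τ' ≫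
        (α_ _ _ _).inv ≫ F ▷ (s₂ ≫ t₂) :=
  calc
    _ = 𝟙 _ ⊗≫ s₀ ◁ (t₀ ◁ H ≫ τ'') ⊗≫ σ'' ▷ t₂ ⊗≫ 𝟙 _ := by
      bicategory
    _ = 𝟙 _ ⊗≫ s₀ ◁ (τ ▷ h' ⊗≫ g ◁ τ') ⊗≫ (s₀ ◁ G ≫ σ'') ▷ t₂ ⊗≫ 𝟙 _ := by
      rw [hτ]
      bicategory
    _ = 𝟙 _ ⊗≫ s₀ ◁ τ ▷ h' ⊗≫ ((s₀ ≫ g) ◁ τ' ≫ σ ▷ (g' ≫ t₂)) ⊗≫ f ◁ σ' ▷ t₂ ⊗≫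
          F ▷ s₂ ▷ t₂ ⊗≫ 𝟙 _ := by
      rw [hσ]
      bicategory
    _ = _ := by
      rw [Bicategory.whisker_exchange]
      bicategory

theorem bicat_hid {a b c : B} {f : a ⟶ a} {g : b ⟶ b} {h : c ⟶ c} {s : a ⟶ b} {t : b ⟶ c}
    (F : 𝟙 a ⟶ f) (G : 𝟙 b ⟶ g) (H : 𝟙 c ⟶ h) (σ : s ≫ g ⟶ f ≫ s) (τ : t ≫ h ⟶ g ≫ t)
    (hσ : s ◁ G ≫ σ = (ρ_ s).hom ≫ (λ_ s).inv ≫ F ▷ s)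
    (hτ : t ◁ H ≫ τ = (ρ_ t).hom ≫ (λ_ t).inv ≫ G ▷ t) :
    (s ≫ t) ◁ H ≫ bicatCmp σ τ =
      (ρ_ (s ≫ t)).hom ≫ (λ_ (s ≫ t)).inv ≫ F ▷ (s ≫ t) :=
  calc
    _ = 𝟙 _ ⊗≫ s ◁ (t ◁ H ≫ τ) ⊗≫ σ ▷ t ⊗≫ 𝟙 _ := by
      bicategory
    _ = 𝟙 _ ⊗≫ (s ◁ G ≫ σ) ▷ t ⊗≫ 𝟙 _ := by
      rw [hτ]
      bicategory
    _ = _ := by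
      rw [hσ]
      bicategory

theorem bicat_id_hcomp {a₀ a₁ a₂ : B} {f : a₀ ⟶ a₁} {f' : a₁ ⟶ a₂} {f'' : a₀ ⟶ a₂}
    (F : f ≫ f' ⟶ f'') :
    𝟙 a₀ ◁ F ≫ (λ_ f'').hom ≫ (ρ_ f'').inv =
      (α_ _ _ _).inv ≫ ((λ_ f).hom ≫ (ρ_ f).inv) ▷ f' ≫ (α_ _ _ _).hom ≫
        f ◁ ((λ_ f').hom ≫ (ρ_ f').inv) ≫ (α_ _ _ _).inv ≫ F ▷ 𝟙 a₂ := by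
  bicategory

theorem bicat_id_hid {a : B} {f : a ⟶ a} (F : 𝟙 a ⟶ f) :
    𝟙 a ◁ F ≫ (λ_ f).hom ≫ (ρ_ f).inv =
      (ρ_ (𝟙 a)).hom ≫ (λ_ (𝟙 a)).inv ≫ F ▷ 𝟙 a := by
  bicategory

theorem bicat_assoc {a₀ a₁ b₀ b₁ c₀ c₁ d₀ d₁ : B}
    {f : a₀ ⟶ a₁} {g : b₀ ⟶ b₁} {h : c₀ ⟶ c₁} {k : d₀ ⟶ d₁}
    {s₀ : a₀ ⟶ b₀} {s₁ : a₁ ⟶ b₁} {t₀ : b₀ ⟶ c₀} {t₁ : b₁ ⟶ c₁} {r₀ : c₀ ⟶ d₀} {r₁ : c₁ ⟶ d₁}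
    (σ : s₀ ≫ g ⟶ f ≫ s₁) (τ : t₀ ≫ h ⟶ g ≫ t₁) (ρ : r₀ ≫ k ⟶ h ≫ r₁) :
    (α_ s₀ t₀ r₀).hom ▷ k ≫ bicatCmp σ (bicatCmp τ ρ) =
      bicatCmp (bicatCmp σ τ) ρ ≫ f ◁ (α_ s₁ t₁ r₁).hom := by
  bicategory

theorem bicat_leftUnitor {a₀ a₁ b₀ b₁ : B} {f : a₀ ⟶ a₁} {g : b₀ ⟶ b₁}
    {s₀ : a₀ ⟶ b₀} {s₁ : a₁ ⟶ b₁} (σ : s₀ ≫ g ⟶ f ≫ s₁) :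
    (λ_ s₀).hom ▷ g ≫ σ = bicatCmp ((λ_ f).hom ≫ (ρ_ f).inv) σ ≫ f ◁ (λ_ s₁).hom := by
  bicategory

theorem bicat_rightUnitor {a₀ a₁ b₀ b₁ : B} {f : a₀ ⟶ a₁} {g : b₀ ⟶ b₁}
    {s₀ : a₀ ⟶ b₀} {s₁ : a₁ ⟶ b₁} (σ : s₀ ≫ g ⟶ f ≫ s₁) :
    (ρ_ s₀).hom ▷ g ≫ σ = bicatCmp σ ((λ_ g).hom ≫ (ρ_ g).inv) ≫ f ◁ (ρ_ s₁).hom := by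
  bicategory

end

section
variable {D : Type u₁} [DoubleCategory.{t₁, w₁, v₁} D]
variable {E : Type u₂} [DoubleCategory.{t₂, w₂, v₂} E]

/-- External composition of lax protransformations. -/
def LaxProtransf.comp {F G H : LaxDoubleFunctor D E} (σ : LaxProtransf F G)
    (τ : LaxProtransf G H) : LaxProtransf F H where
  pro x := σ.pro x ⊙ τ.pro x
  arr f := hcompMap (σ.arr f) (τ.arr f) (by simp)
  src_arr f := by simp
  tgt_arr f := by simp
  comparison m := compCmp (σ.comparison m) (τ.comparison m)
  arr_id x := (hcompMap_congr (σ.arr_id x) (τ.arr_id x)).trans (hcompMap_id _ _)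
  arr_comp f g := (hcompMap_congr (σ.arr_comp f g) (τ.arr_comp f g)).trans
    (hcompMap_comp _ _ _ _ _ _)
  naturality γ := (compCmp_sq _ _ _ _ _ (G.mapCell γ) _ _ _ _ _ (by simp) (by simp) (by simp)
    (by simp) (by simp) (by simp) (σ.naturality γ).symm (τ.naturality γ).symm).symm
  comparison_hcomp m n := bicat_hcomp (B := UBicat E) _ _ _ _ _ _ _ _ _
    (σ.comparison_hcomp m n) (τ.comparison_hcomp m n)
  comparison_hid x := bicat_hid (B := UBicat E) _ _ _ _ _
    (σ.comparison_hid x) (τ.comparison_hid x)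

/-- The identity protransformation. -/
def LaxProtransf.id (F : LaxDoubleFunctor D E) : LaxProtransf F F where
  pro x := hid (F.obj x)
  arr f := hidMap (F.map f)
  src_arr f := by simp
  tgt_arr f := by simp
  comparison m := idCmp (F.mapPro m)
  arr_id x := by rw [F.map_id, hidMap_id]
  arr_comp f g := by rw [F.map_comp, hidMap_comp]
  naturality γ := (idCmp_sq _ (by simp) (by simp)).symm
  comparison_hcomp m n := bicat_id_hcomp (B := UBicat E) _
  comparison_hid x := bicat_id_hid (B := UBicat E) _

def PseudoProtransf.comp {F G H : LaxDoubleFunctor D E} (σ : PseudoProtransf F G)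
    (τ : PseudoProtransf G H) : PseudoProtransf F H where
  toLaxProtransf := σ.toLaxProtransf.comp τ.toLaxProtransf
  isIso_comparison m := isIso_compCmp (σ.comparison m) (τ.comparison m)

def PseudoProtransf.id (F : LaxDoubleFunctor D E) : PseudoProtransf F F where
  toLaxProtransf := LaxProtransf.id F
  isIso_comparison m := isIso_idCmp (F.mapPro m)

/-- Internal (vertical) identities and composition of modifications. -/
def Modif.id {F G : LaxDoubleFunctor D E} (σ : LaxProtransf F G) : Modif σ σ where
  left := 𝟙 F
  right := 𝟙 G
  app x := 𝟙 (Loose.mk (σ.pro x))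
  src_app x := src_id _
  tgt_app x := tgt_id _
  arr_equivariance f := by rw [Category.id_comp, Category.comp_id]
  pro_equivariance m := by
    refine (congrArg (· ≫ _) (hcompMap_id _ _)).trans (Eq.trans ?_
      (congrArg (_ ≫ ·) (hcompMap_id _ _).symm))
    rw [Category.id_comp, Category.comp_id]

def Modif.comp {F G F' G' F'' G'' : LaxDoubleFunctor D E} {σ : LaxProtransf F G}
    {τ : LaxProtransf F' G'} {ρ : LaxProtransf F'' G''} (μ : Modif σ τ) (ν : Modif τ ρ) :
    Modif σ ρ where
  left := μ.left ≫ ν.left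
  right := μ.right ≫ ν.right
  app x := μ.app x ≫ ν.app x
  src_app x := by rw [src_comp, μ.src_app, ν.src_app]; rfl
  tgt_app x := by rw [tgt_comp, μ.tgt_app, ν.tgt_app]; rfl
  arr_equivariance f := by
    rw [Category.assoc, ν.arr_equivariance, ← Category.assoc, μ.arr_equivariance,
      Category.assoc]
  pro_equivariance m := by
    refine (congrArg (· ≫ _) (hcompMap_comp _ _ _ _ (by simp) (by simp))).trans (Eq.trans ?_
      (congrArg (_ ≫ ·) (hcompMap_comp _ _ _ _ (by simp) (by simp)).symm))
    rw [Category.assoc, ν.pro_equivariance, ← Category.assoc, μ.pro_equivariance,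
      Category.assoc]

/-- External composition of modifications. -/
def Modif.hcomp {F G H F' G' H' : LaxDoubleFunctor D E} {σ : LaxProtransf F G}
    {τ : LaxProtransf G H} {σ' : LaxProtransf F' G'} {τ' : LaxProtransf G' H'}
    (μ : Modif σ σ') (ν : Modif τ τ') (h : μ.right = ν.left) :
    Modif (σ.comp τ) (σ'.comp τ') where
  left := μ.left
  right := ν.right
  app x := hcompMap (μ.app x) (ν.app x) (by simp [h])
  src_app x := (src_hcompMap _ _ _).trans (μ.src_app x)
  tgt_app x := (tgt_hcompMap _ _ _).trans (ν.tgt_app x)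
  arr_equivariance f := hcompMap_sq _ _ _ _ (μ.arr_equivariance f) (ν.arr_equivariance f)
  pro_equivariance m := compCmp_sq _ _ _ _ _ (μ.right.cell m) _ _ _ _ _ (by simp) (by simp)
    (by simp) (by simp [h]) (by simp [h]) (by simp [h]) (μ.pro_equivariance m)
    (by simpa [h] using ν.pro_equivariance m)

/-- The external identity modification on a natural transformation. -/
def Modif.hid {F G : LaxDoubleFunctor D E} (α : F ⟶ G) :
    Modif (LaxProtransf.id F) (LaxProtransf.id G) where
  left := α
  right := α
  app x := hidMap (α.app x)
  src_app x := src_hidMap _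
  tgt_app x := tgt_hidMap _
  arr_equivariance f := by
    refine (hidMap_comp _ _).symm.trans (Eq.trans ?_ (hidMap_comp _ _))
    rw [α.naturality]
  pro_equivariance m := idCmp_sq _ (by simp) (by simp)

/-- Modifications with identity boundaries, from globular components. -/
def Modif.ofGlob {F G : LaxDoubleFunctor D E} {σ τ : LaxProtransf F G}
    (e : ∀ x, σ.pro x ⟶ τ.pro x)
    (h : ∀ {x y : D} (f : x ⟶ y), (e x).cell ≫ τ.arr f = σ.arr f ≫ (e y).cell)
    (h' : ∀ {x y : D} (m : x ⇸ y),
      e x ▷ₚ G.mapPro m ≫ τ.comparison m = σ.comparison m ≫ F.mapPro m ◁ₚ e y) :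
    Modif σ τ where
  left := 𝟙 F
  right := 𝟙 G
  app x := (e x).cell
  src_app x := (e x).src_cell
  tgt_app x := (e x).tgt_cell
  arr_equivariance f := h f
  pro_equivariance m := congrArg Glob.cell (h' m)

end

/-- The double category `LaxPs(D, E)`: its objects are the lax double functors `D → E`. -/
def LaxPs (D : Type u₁) [DoubleCategory.{t₁, w₁, v₁} D] (E : Type u₂)
    [DoubleCategory.{t₂, w₂, v₂} E] := LaxDoubleFunctor D E

section
variable {D : Type u₁} [DoubleCategory.{t₁, w₁, v₁} D]
variable {E : Type u₂} [DoubleCategory.{t₂, w₂, v₂} E]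

/-- Arrows are natural transformations, proarrows are pseudo protransformations, and cells are
modifications. -/
instance : PreDoubleCategory.{max u₁ w₁ v₂ t₂, max u₁ v₁ w₁ w₂ t₂, max u₁ w₁ v₂ t₂}
    (LaxPs D E) where
  toCategory := inferInstanceAs (Category (LaxDoubleFunctor D E))
  Pro F G := PseudoProtransf (D := D) (E := E) F G
  cellCategory :=
    { Hom := fun P Q => Modif P.pro.toLaxProtransf Q.pro.toLaxProtransf
      id := fun P => Modif.id P.pro.toLaxProtransf
      comp := fun μ ν => Modif.comp μ ν
      id_comp := fun _ => Modif.ext' (Category.id_comp _) (Category.id_comp _)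
        (fun _ => Category.id_comp _)
      comp_id := fun _ => Modif.ext' (Category.comp_id _) (Category.comp_id _)
        (fun _ => Category.comp_id _)
      assoc := fun _ _ _ => Modif.ext' (Category.assoc _ _ _) (Category.assoc _ _ _)
        (fun _ => Category.assoc _ _ _) }
  src μ := Modif.left μ
  tgt μ := Modif.right μ
  src_id _ := rfl
  tgt_id _ := rfl
  src_comp _ _ := rfl
  tgt_comp _ _ := rfl

/-- The pseudo protransformation underlying a proarrow of `LaxPs D E`. -/
abbrev LaxPs.toProtransf {F G : LaxPs D E} (σ : F ⇸ G) :
    PseudoProtransf (D := D) (E := E) F G := σ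

/-- Globular isomorphisms in `LaxPs D E`, from globular isomorphisms of components. -/
def LaxPs.mkIso {F G : LaxPs D E} {σ τ : F ⇸ G}
    (e : ∀ x, (toProtransf σ).pro x ≅ (toProtransf τ).pro x)
    (h : ∀ {x y : D} (f : x ⟶ y),
      (e x).hom.cell ≫ (toProtransf τ).arr f = (toProtransf σ).arr f ≫ (e y).hom.cell)
    (h' : ∀ {x y : D} (m : x ⇸ y),
      (e x).hom ▷ₚ LaxDoubleFunctor.mapPro G m ≫ (toProtransf τ).comparison m =
        (toProtransf σ).comparison m ≫ LaxDoubleFunctor.mapPro F m ◁ₚ (e y).hom) :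
    σ ≅ τ where
  hom := ⟨Modif.ofGlob (fun x => (e x).hom) h h', rfl, rfl⟩
  inv := ⟨Modif.ofGlob (fun x => (e x).inv) (fun f => inv_sq _ _ (h f).symm) (fun {x y} m => by
      have h₁ : (e x).inv ▷ₚ LaxDoubleFunctor.mapPro G m ≫ (e x).hom ▷ₚ LaxDoubleFunctor.mapPro G m = 𝟙 _ := by
        rw [← comp_whiskerR, Iso.inv_hom_id, id_whiskerR]
      have h₂ : LaxDoubleFunctor.mapPro F m ◁ₚ (e y).hom ≫ LaxDoubleFunctor.mapPro F m ◁ₚ (e y).inv = 𝟙 _ := by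
        rw [← whiskerL_comp, Iso.hom_inv_id, whiskerL_id]
      calc (e x).inv ▷ₚ LaxDoubleFunctor.mapPro G m ≫ (toProtransf σ).comparison m
          = (e x).inv ▷ₚ LaxDoubleFunctor.mapPro G m ≫ ((toProtransf σ).comparison m ≫ LaxDoubleFunctor.mapPro F m ◁ₚ (e y).hom) ≫
              LaxDoubleFunctor.mapPro F m ◁ₚ (e y).inv := by
            rw [Category.assoc, h₂, Category.comp_id]
        _ = ((e x).inv ▷ₚ LaxDoubleFunctor.mapPro G m ≫ (e x).hom ▷ₚ LaxDoubleFunctor.mapPro G m) ≫ (toProtransf τ).comparison m ≫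
              LaxDoubleFunctor.mapPro F m ◁ₚ (e y).inv := by
            rw [← h']; simp only [Category.assoc]
        _ = _ := by rw [h₁, Category.id_comp]), rfl, rfl⟩
  hom_inv_id := Glob.ext (Modif.ext' (Category.id_comp _) (Category.id_comp _)
    (fun x => congrArg Glob.cell (e x).hom_inv_id))
  inv_hom_id := Glob.ext (Modif.ext' (Category.id_comp _) (Category.id_comp _)
    (fun x => congrArg Glob.cell (e x).inv_hom_id))

instance : DoubleCategory.{max u₁ w₁ v₂ t₂, max u₁ v₁ w₁ w₂ t₂, max u₁ w₁ v₂ t₂}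
    (LaxPs D E) where
  hid F := PseudoProtransf.id F
  hidMap α := Modif.hid α
  src_hidMap _ := rfl
  tgt_hidMap _ := rfl
  hidMap_id F := Modif.ext' rfl rfl (fun x => hidMap_id _)
  hidMap_comp α β := Modif.ext' rfl rfl (fun x => hidMap_comp _ _)
  hcomp σ τ := PseudoProtransf.comp σ τ
  hcompMap μ ν h := Modif.hcomp μ ν h
  src_hcompMap _ _ _ := rfl
  tgt_hcompMap _ _ _ := rfl
  hcompMap_id σ τ := Modif.ext' rfl rfl (fun x => hcompMap_id _ _)
  hcompMap_comp μ ν μ' ν' h h' := Modif.ext' rfl rfl (fun x => hcompMap_comp _ _ _ _ _ _)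
  hassoc σ τ ρ := LaxPs.mkIso (σ := PseudoProtransf.comp (PseudoProtransf.comp σ τ) ρ)
    (τ := PseudoProtransf.comp σ (PseudoProtransf.comp τ ρ)) (fun x => hassoc _ _ _)
    (fun f => (hassoc_naturality _ _ _ _ _).symm)
    (fun m => bicat_assoc (B := UBicat E) _ _ _)
  hassoc_naturality μ ν κ h h' := Modif.ext'
    ((Category.comp_id _).trans (Category.id_comp _).symm)
    ((Category.comp_id _).trans (Category.id_comp _).symm)
    (fun x => hassoc_naturality _ _ _ _ _)
  leftUnitor {F _} σ := LaxPs.mkIso (σ := PseudoProtransf.comp (PseudoProtransf.id F) σ)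
    (τ := σ) (fun x => leftUnitor _)
    (fun f => by
      refine (leftUnitor_naturality _).symm.trans (congrArg (· ≫ _) ?_)
      exact hcompMap_congr (congrArg hidMap (LaxProtransf.src_arr _ f)) rfl)
    (fun m => bicat_leftUnitor (B := UBicat E) _)
  leftUnitor_naturality μ := Modif.ext'
    ((Category.comp_id _).trans (Category.id_comp _).symm)
    ((Category.comp_id _).trans (Category.id_comp _).symm)
    (fun x => by
      refine Eq.trans (congrArg (· ≫ _) ?_) (leftUnitor_naturality (Modif.app μ x))
      exact hcompMap_congr (congrArg hidMap (Modif.src_app μ x).symm) rfl)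
  rightUnitor {_ G} σ := LaxPs.mkIso (σ := PseudoProtransf.comp σ (PseudoProtransf.id G))
    (τ := σ) (fun x => rightUnitor _)
    (fun f => by
      refine (rightUnitor_naturality _).symm.trans (congrArg (· ≫ _) ?_)
      exact hcompMap_congr rfl (congrArg hidMap (LaxProtransf.tgt_arr _ f)))
    (fun m => bicat_rightUnitor (B := UBicat E) _)
  rightUnitor_naturality μ := Modif.ext'
    ((Category.comp_id _).trans (Category.id_comp _).symm)
    ((Category.comp_id _).trans (Category.id_comp _).symm)
    (fun x => by
      refine Eq.trans (congrArg (· ≫ _) ?_) (rightUnitor_naturality (Modif.app μ x))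
      exact hcompMap_congr rfl (congrArg hidMap (Modif.tgt_app μ x).symm))
  pentagon σ τ ρ κ := Modif.ext' (Category.id_comp _) (Category.id_comp _) (fun x => pentagon _ _ _ _)
  triangle σ τ := Modif.ext' (Category.id_comp _) (Category.id_comp _) (fun x => triangle _ _)

end
end DoubleCat

open DoubleCat

/-!
For a companion `g_!` with unit `η`, the cell `1_m ⊙ η` is opcartesian, so a globular cell out of
`m ⊙ g_!` is determined by its restriction along `η`. Hence the slide `θ_! : m ⊙ g_! ⟶ f_! ⊙ n` of a
cell `θ` is characterised by a single square relating it to `η_f ⊙ θ`, and the naturality of slides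
and their compatibility with `⊙` and external identities follow by pasting such squares. The
equivariance at a proarrow `m` of the unit modification of a companion of `α` says exactly that its
comparison at `m` is inverse to the slide of `α_m`. So the slides of a transformation with a
companion are invertible, and conversely invertible slides assemble, by their naturality and
compatibility with composition, into a pseudo protransformation. Conjoints are companions in the
horizontal opposite, where the comparison at `m` is the slide itself.
-/

namespace DoubleCat
open PreDoubleCategory DoubleCategory
open scoped Bicategory

theorem bicatCmp_unitors {B : Type u} [Bicategory.{w, v} B] {a b c : B} (m : a ⟶ b) (n : b ⟶ c) :
    bicatCmp ((ρ_ m).hom ≫ (λ_ m).inv) ((ρ_ n).hom ≫ (λ_ n).inv) =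
      (ρ_ (m ≫ n)).hom ≫ (λ_ (m ≫ n)).inv := by
  bicategory

section
variable {D : Type u} [DoubleCategory.{t, w, v} D]

theorem cell_hom_inv_id {x y : D} {m n : x ⇸ y} (e : m ≅ n) :
    e.hom.cell ≫ e.inv.cell = 𝟙 (Loose.mk m) := congrArg Glob.cell e.hom_inv_id

theorem cell_inv_hom_id {x y : D} {m n : x ⇸ y} (e : m ≅ n) :
    e.inv.cell ≫ e.hom.cell = 𝟙 (Loose.mk n) := congrArg Glob.cell e.inv_hom_id

theorem hcompMap_hidMap_rightUnitor {x y x' y' : D} {m : x ⇸ y} {n : x' ⇸ y'} (φ : Cell m n)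
    {v : y ⟶ y'} (h : tgt φ = v) :
    hcompMap φ (hidMap v) (h.trans (src_hidMap v).symm) ≫ (rightUnitor n).hom.cell =
      (rightUnitor m).hom.cell ≫ φ := by
  subst h
  exact rightUnitor_naturality φ

theorem hcompMap_hidMap_leftUnitor {x y x' y' : D} {m : x ⇸ y} {n : x' ⇸ y'} (φ : Cell m n)
    {u : x ⟶ x'} (h : src φ = u) :
    hcompMap (hidMap u) φ ((tgt_hidMap u).trans h.symm) ≫ (leftUnitor n).hom.cell =
      (leftUnitor m).hom.cell ≫ φ := by
  subst h
  exact leftUnitor_naturality φ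

theorem hassoc_inv_naturality {x y z s x' y' z' s' : D} {m : x ⇸ y} {n : y ⇸ z} {p : z ⇸ s}
    {m' : x' ⇸ y'} {n' : y' ⇸ z'} {p' : z' ⇸ s'}
    (α : Cell m m') (β : Cell n n') (γ : Cell p p') (h : tgt α = src β) (h' : tgt β = src γ) :
    hcompMap α (hcompMap β γ h') (h.trans (src_hcompMap β γ h').symm) ≫
        (hassoc m' n' p').inv.cell =
      (hassoc m n p).inv.cell ≫
        hcompMap (hcompMap α β h) γ ((tgt_hcompMap α β h).trans h') :=
  (inv_sq _ _ (hassoc_naturality α β γ h h')).symm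

theorem leftUnitor_hid (x : D) : leftUnitor (hid x) = rightUnitor (hid x) :=
  Iso.ext (Bicategory.unitors_equal (B := UBicat D) (a := x))

theorem hassoc_inv_rightUnitor {x y z : D} (m : x ⇸ y) (n : y ⇸ z) :
    (hassoc m n (hid z)).inv ≫ (rightUnitor (m ⊙ n)).hom = m ◁ₚ (rightUnitor n).hom :=
  (Iso.inv_comp_eq _).mpr (Bicategory.rightUnitor_comp (B := UBicat D) m n)

/-- The invertible globular cell `idCmp`, bundled with its inverse. -/
def idCmpIso {x y : D} (m : x ⇸ y) : hid x ⊙ m ≅ m ⊙ hid y :=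
  leftUnitor m ≪≫ (rightUnitor m).symm

theorem idCmpIso_inv_naturality {x y x' y' : D} {m : x ⇸ y} {n : x' ⇸ y'} (α : Cell m n)
    {f : x ⟶ x'} {g : y ⟶ y'} (hf : src α = f) (hg : tgt α = g) :
    hcompMap α (hidMap g) (hg.trans (src_hidMap g).symm) ≫ (idCmpIso n).inv.cell =
      (idCmpIso m).inv.cell ≫ hcompMap (hidMap f) α ((tgt_hidMap f).trans hf.symm) :=
  (inv_sq (idCmpIso m) (idCmpIso n) (idCmp_sq α hf hg)).symm

theorem idCmpIso_hid_inv (x : D) : (idCmpIso (hid x)).inv = idCmp (hid x) := by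
  simp [idCmpIso, idCmp, leftUnitor_hid]

theorem compCmp_idCmpIso_inv {x y z : D} (m : x ⇸ y) (n : y ⇸ z) :
    compCmp (idCmpIso m).inv (idCmpIso n).inv = (idCmpIso (m ⊙ n)).inv :=
  bicatCmp_unitors (B := UBicat D) m n

end

namespace Companion

attribute [simp] Companion.src_unit Companion.tgt_unit Companion.src_counit Companion.tgt_counit

section
variable {D : Type u} [DoubleCategory.{t, w, v} D]

/-- The cell `1_m ⊙ η` is opcartesian: by the companion equations, `ψ` is recovered by pasting `ε`
to the right of its restriction. -/
theorem hcompMap_unit_ext {x y z w w' : D} {f : x ⟶ y} (c : Companion f) {m : z ⇸ x}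
    {q : w ⇸ w'} {ψ ψ' : Cell (m ⊙ c.pro) q} (ht : tgt ψ = tgt ψ')
    (h : hcompMap (𝟙 (Loose.mk m)) c.unit (by simp) ≫ ψ =
      hcompMap (𝟙 (Loose.mk m)) c.unit (by simp) ≫ ψ') : ψ = ψ' := by
  have reconstruct (ψ : Cell (m ⊙ c.pro) q) : ψ =
      (m ◁ₚ (leftUnitor c.pro).inv).cell ≫ (hassoc m (hid x) c.pro).inv.cell ≫
        hcompMap (hcompMap (𝟙 (Loose.mk m)) c.unit (by simp) ≫ ψ) (c.counit ≫ hidMap (tgt ψ))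
          (by simp) ≫ (rightUnitor q).hom.cell := by
    rw [hcompMap_comp (hcompMap (𝟙 (Loose.mk m)) c.unit (by simp)) c.counit ψ (hidMap (tgt ψ))
        (by simp) (by simp), Category.assoc, rightUnitor_naturality ψ,
      ← reassoc_of% (hassoc_inv_naturality (𝟙 (Loose.mk m)) c.unit c.counit (by simp) (by simp)),
      ← Category.assoc (hassoc m c.pro (hid y)).inv.cell, ← glob_comp_cell,
      hassoc_inv_rightUnitor]
    have zigzag : (m ◁ₚ (leftUnitor c.pro).inv).cell ≫
        hcompMap (𝟙 (Loose.mk m)) (hcompMap c.unit c.counit (by simp)) (by simp) ≫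
          (m ◁ₚ (rightUnitor c.pro).hom).cell = 𝟙 _ := by
      simp only [whiskerL]
      rw [← hcompMap_comp, ← hcompMap_comp, ← hcompMap_id]
      exact hcompMap_congr (by simp) c.unit_hcomp_counit
    rw [reassoc_of% zigzag]
  rw [reconstruct ψ, reconstruct ψ']
  exact congrArg (_ ≫ _ ≫ · ≫ _) (hcompMap_congr h (by rw [ht]))

theorem unit_ext {x y z w : D} {f : x ⟶ y} (c : Companion f) {q : z ⇸ w} {ψ ψ' : Cell c.pro q}
    (ht : tgt ψ = tgt ψ') (h : c.unit ≫ ψ = c.unit ≫ ψ') : ψ = ψ' := by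
  have restrict (ψ : Cell c.pro q) :
      hcompMap (𝟙 (Loose.mk (hid x))) c.unit (by simp) ≫ (leftUnitor c.pro).hom.cell ≫ ψ =
        (leftUnitor (hid x)).hom.cell ≫ c.unit ≫ ψ := by
    rw [← Category.assoc, ← Category.assoc, ← hcompMap_hidMap_leftUnitor c.unit c.src_unit,
      hcompMap_congr (hidMap_id x) rfl]
  have cancel := c.hcompMap_unit_ext (ψ := (leftUnitor c.pro).hom.cell ≫ ψ)
    (ψ' := (leftUnitor c.pro).hom.cell ≫ ψ') (by simp [ht]) (by rw [restrict, restrict, h])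
  have := congrArg ((leftUnitor c.pro).inv.cell ≫ ·) cancel
  simpa only [reassoc_of% (cell_inv_hom_id (leftUnitor c.pro))] using this

end

section
variable {D : Type u} [DoubleCategory.{t, w, v} D] {x y x' y' : D} {f : x ⟶ y} {g : x' ⟶ y'}

/-- The cell `f_! ⟶ g_!` induced by a commutative square of arrows. -/
def map (c : Companion f) (d : Companion g) (u : x ⟶ x') (v : y ⟶ y') (h : u ≫ g = f ≫ v) :
    Cell c.pro d.pro :=
  (leftUnitor c.pro).inv.cell ≫
    hcompMap (hidMap u ≫ d.unit) (c.counit ≫ hidMap v) (by simp [h]) ≫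
      (rightUnitor d.pro).hom.cell

variable (c : Companion f) (d : Companion g) (u : x ⟶ x') (v : y ⟶ y') (h : u ≫ g = f ≫ v)

@[simp] theorem src_map : src (c.map d u v h) = u := by simp [map]

@[simp] theorem tgt_map : tgt (c.map d u v h) = v := by simp [map]

theorem unit_map : c.unit ≫ c.map d u v h = hidMap u ≫ d.unit := by
  have pasted : hcompMap (hidMap (𝟙 x) ≫ hidMap u ≫ d.unit) (c.unit ≫ c.counit ≫ hidMap v)
      (by simp [h]) = hcompMap (hidMap u ≫ d.unit) (hidMap (f ≫ v)) (by simp [h]) :=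
    hcompMap_congr (by rw [hidMap_id, Category.id_comp])
      (by rw [reassoc_of% c.unit_comp_counit, hidMap_comp])
  rw [map, ← reassoc_of% (inv_sq (leftUnitor _) (leftUnitor _)
    (hcompMap_hidMap_leftUnitor c.unit c.src_unit)),
    ← reassoc_of% (hcompMap_comp (hidMap (𝟙 x)) c.unit _ _ (by simp) (by simp [h])), pasted,
    hcompMap_hidMap_rightUnitor _ (by simp [h]), ← leftUnitor_hid,
    reassoc_of% (cell_inv_hom_id (leftUnitor (hid x)))]

theorem map_counit : c.map d u v h ≫ d.counit = c.counit ≫ hidMap v := by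
  have pasted : hcompMap ((hidMap u ≫ d.unit) ≫ d.counit) ((c.counit ≫ hidMap v) ≫ hidMap (𝟙 y'))
      (by simp [h]) = hcompMap (hidMap (f ≫ v)) (c.counit ≫ hidMap v) (by simp) :=
    hcompMap_congr (by rw [Category.assoc, d.unit_comp_counit, ← hidMap_comp, h])
      (by rw [hidMap_id, Category.comp_id])
  rw [map, Category.assoc, Category.assoc, ← hcompMap_hidMap_rightUnitor d.counit d.tgt_counit,
    ← reassoc_of% (hcompMap_comp _ _ d.counit (hidMap (𝟙 y')) (by simp [h]) (by simp)), pasted,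
    ← leftUnitor_hid, hcompMap_hidMap_leftUnitor _ (by simp),
    reassoc_of% (cell_inv_hom_id (leftUnitor c.pro))]

theorem map_id : c.map c (𝟙 x) (𝟙 y) (by simp) = 𝟙 (Loose.mk c.pro) :=
  c.unit_ext (by simp) (by rw [unit_map, hidMap_id, Category.id_comp, Category.comp_id])

theorem map_comp {x'' y'' : D} {k : x'' ⟶ y''} (e : Companion k) (u' : x' ⟶ x'') (v' : y' ⟶ y'')
    (h' : u' ≫ k = g ≫ v') :
    c.map e (u ≫ u') (v ≫ v') (by rw [Category.assoc, h', reassoc_of% h]) =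
      c.map d u v h ≫ d.map e u' v' h' :=
  c.unit_ext (by simp) (by
    rw [unit_map, reassoc_of% (c.unit_map d u v h), unit_map, hidMap_comp, Category.assoc])

theorem map_id_comp_map_id (c' : Companion f) :
    c.map c' (𝟙 x) (𝟙 y) (by simp) ≫ c'.map c (𝟙 x) (𝟙 y) (by simp) = 𝟙 (Loose.mk c.pro) := by
  rw [← map_comp]
  simp [map_id]

end

section
variable {D : Type u} [DoubleCategory.{t, w, v} D] {x y x' y' : D}
  {f : x ⟶ x'} {g : y ⟶ y'} {m : x ⇸ y} {n : x' ⇸ y'}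
  (cf : Companion f) (cg : Companion g) (α : Cell m n) (hf : src α = f) (hg : tgt α = g)

theorem unit_slideCompanion :
    hcompMap (𝟙 (Loose.mk m)) cg.unit (by simp) ≫ (slideCompanion cf cg α hf hg).cell =
      (idCmpIso m).inv.cell ≫ hcompMap cf.unit α (by simp [hf]) := by
  have slide_cell : (slideCompanion cf cg α hf hg).cell =
      hcompMap (leftUnitor m).inv.cell (𝟙 (Loose.mk cg.pro)) (by simp) ≫
        hcompMap (hcompMap cf.unit α (by simp [hf])) cg.counit (by simp [hg]) ≫
          (rightUnitor _).hom.cell := rfl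
  have pasted : hcompMap ((leftUnitor m).inv.cell ≫
      hcompMap cf.unit α (by simp [hf])) (cg.unit ≫ 𝟙 (Loose.mk cg.pro) ≫ cg.counit)
        (by simp [hg]) =
      hcompMap ((leftUnitor m).inv.cell ≫ hcompMap cf.unit α (by simp [hf])) (hidMap g)
        (by simp [hg]) :=
    hcompMap_congr rfl (by rw [Category.id_comp, cg.unit_comp_counit])
  have conjugate : (idCmpIso m).inv.cell =
      (rightUnitor m).hom.cell ≫ (leftUnitor m).inv.cell := rfl
  rw [slide_cell, ← Category.assoc (hcompMap (leftUnitor m).inv.cell _ _), ← hcompMap_comp,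
    ← reassoc_of% (hcompMap_comp (𝟙 (Loose.mk m)) cg.unit _ _ (by simp) (by simp [hg])), pasted,
    hcompMap_hidMap_rightUnitor _ (by simp [hg]), conjugate, Category.assoc]

theorem slideCompanion_eq_of_unit {S : m ⊙ cg.pro ⟶ cf.pro ⊙ n}
    (h : hcompMap (𝟙 (Loose.mk m)) cg.unit (by simp) ≫ S.cell =
      (idCmpIso m).inv.cell ≫ hcompMap cf.unit α (by simp [hf])) :
    slideCompanion cf cg α hf hg = S :=
  glob_ext (cg.hcompMap_unit_ext (by simp) ((unit_slideCompanion cf cg α hf hg).trans h.symm))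

theorem slideCompanion_counit :
    (slideCompanion cf cg α hf hg).cell ≫ hcompMap cf.counit (𝟙 (Loose.mk n)) (by simp) =
      hcompMap α cg.counit (by simp [hg]) ≫ (idCmpIso n).inv.cell := by
  refine cg.hcompMap_unit_ext (by simp) ?_
  calc
    _ = (idCmpIso m).inv.cell ≫ hcompMap cf.unit α (by simp [hf]) ≫
          hcompMap cf.counit (𝟙 (Loose.mk n)) (by simp) := by
      rw [reassoc_of% (unit_slideCompanion cf cg α hf hg)]
    _ = (idCmpIso m).inv.cell ≫ hcompMap (hidMap f) α (by simp [hf]) := by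
      rw [← hcompMap_comp]
      exact congrArg (_ ≫ ·) (hcompMap_congr cf.unit_comp_counit (Category.comp_id _))
    _ = hcompMap α (hidMap g) (by simp [hg]) ≫ (idCmpIso n).inv.cell :=
      (idCmpIso_inv_naturality α hf hg).symm
    _ = _ := by
      rw [← Category.assoc, ← hcompMap_comp]
      exact congrArg (· ≫ _)
        (hcompMap_congr (Category.id_comp _).symm cg.unit_comp_counit.symm)

theorem slideCompanion_naturality {a b a' b' : D} {p : a ⇸ b} {q : a' ⇸ b'} {f' : a ⟶ a'}
    {g' : b ⟶ b'} (cf' : Companion f') (cg' : Companion g') (β : Cell p q) (hf' : src β = f')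
    (hg' : tgt β = g') (γ : Cell m p) (δ : Cell n q) (h : γ ≫ β = α ≫ δ)
    (hs : src γ ≫ f' = f ≫ src δ) (ht : tgt γ ≫ g' = g ≫ tgt δ) :
    (slideCompanion cf cg α hf hg).cell ≫ hcompMap (cf.map cf' _ _ hs) δ (by simp) =
      hcompMap γ (cg.map cg' _ _ ht) (by simp) ≫ (slideCompanion cf' cg' β hf' hg').cell := by
  refine cg.hcompMap_unit_ext (by simp) ?_
  calc
    _ = (idCmpIso m).inv.cell ≫ hcompMap cf.unit α (by simp [hf]) ≫
          hcompMap (cf.map cf' _ _ hs) δ (by simp) := by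
      rw [reassoc_of% (unit_slideCompanion cf cg α hf hg)]
    _ = (idCmpIso m).inv.cell ≫ hcompMap (hidMap (src γ)) γ (by simp) ≫
          hcompMap cf'.unit β (by simp [hf']) := by
      rw [← hcompMap_comp, ← hcompMap_comp]
      exact congrArg (_ ≫ ·) (hcompMap_congr (unit_map ..) h.symm)
    _ = hcompMap γ (hidMap (tgt γ)) (by simp) ≫ (idCmpIso p).inv.cell ≫
          hcompMap cf'.unit β (by simp [hf']) := by
      rw [reassoc_of% (idCmpIso_inv_naturality γ rfl rfl)]
    _ = hcompMap γ (hidMap (tgt γ)) (by simp) ≫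
          hcompMap (𝟙 (Loose.mk p)) cg'.unit (by simp) ≫
            (slideCompanion cf' cg' β hf' hg').cell := by
      rw [unit_slideCompanion]
    _ = _ := by
      rw [← Category.assoc, ← hcompMap_comp, ← Category.assoc, ← hcompMap_comp]
      exact congrArg (· ≫ _) (hcompMap_congr
        ((Category.comp_id _).trans (Category.id_comp _).symm) (unit_map ..).symm)

end

section
variable {D : Type u} [DoubleCategory.{t, w, v} D] {x y z x' y' z' : D}
  {f : x ⟶ x'} {g : y ⟶ y'} {h : z ⟶ z'} (cf : Companion f) (cg : Companion g) (ch : Companion h)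

theorem slideCompanion_comp_glob {m p : x ⇸ y} {n q : x' ⇸ y'} (α : Cell m n) (β : Cell p q)
    (hα : src α = f) (hα' : tgt α = g) (hβ : src β = f) (hβ' : tgt β = g) (φ : m ⟶ p) (ψ : n ⟶ q)
    (w : φ.cell ≫ β = α ≫ ψ.cell) :
    φ ▷ₚ cg.pro ≫ slideCompanion cf cg β hβ hβ' =
      slideCompanion cf cg α hα hα' ≫ cf.pro ◁ₚ ψ := by
  refine glob_ext (Eq.trans ?_ ((slideCompanion_naturality cf cg α hα hα' cf cg β hβ hβ' φ.cell
    ψ.cell w (by simp) (by simp)).symm.trans ?_))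
  · exact congrArg (· ≫ _) (hcompMap_congr rfl (by simp [map_id]))
  · exact congrArg (_ ≫ ·) (hcompMap_congr (by simp [map_id]) rfl)

theorem slideCompanion_hidMap :
    slideCompanion cf cf (hidMap f) (src_hidMap f) (tgt_hidMap f) = idCmp cf.pro :=
  slideCompanion_eq_of_unit cf cf _ _ _ (by
    rw [idCmpIso_hid_inv, ← idCmp_sq cf.unit cf.src_unit cf.tgt_unit]
    exact congrArg (· ≫ _) (hcompMap_congr (hidMap_id x).symm rfl))

theorem slideCompanion_hcompMap {m : x ⇸ y} {m' : y ⇸ z} {n : x' ⇸ y'} {n' : y' ⇸ z'}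
    (α : Cell m n) (β : Cell m' n') (hα : src α = f) (hα' : tgt α = g) (hβ : src β = g)
    (hβ' : tgt β = h) :
    slideCompanion cf ch (hcompMap α β (hα'.trans hβ.symm)) (by simp [hα]) (by simp [hβ']) =
      compCmp (slideCompanion cf cg α hα hα') (slideCompanion cg ch β hβ hβ') :=
  slideCompanion_eq_of_unit cf ch _ _ _ (by
    have := compCmp_sq _ _ _ _ cf.unit cg.unit ch.unit (𝟙 (Loose.mk m)) α (𝟙 (Loose.mk m')) β
      (by simp) (by simp [hα]) (by simp) (by simp [hβ]) (by simp) (hα'.trans hβ.symm)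
      (unit_slideCompanion cf cg α hα hα') (unit_slideCompanion cg ch β hβ hβ')
    rw [compCmp_idCmpIso_inv] at this
    rw [← this]
    exact congrArg (· ≫ _) (hcompMap_congr (hcompMap_id _ _).symm rfl))

/-- The canonical isomorphism between two companions of the same arrow. -/
def uniqueIso (c c' : Companion f) : c.pro ≅ c'.pro where
  hom := ⟨c.map c' (𝟙 x) (𝟙 x') (by simp), by simp, by simp⟩
  inv := ⟨c'.map c (𝟙 x) (𝟙 x') (by simp), by simp, by simp⟩
  hom_inv_id := glob_ext (c.map_id_comp_map_id c')
  inv_hom_id := glob_ext (c'.map_id_comp_map_id c)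

end

theorem slideCompanion_uniqueIso {D : Type u} [DoubleCategory.{t, w, v} D] {x y x' y' : D}
    {f : x ⟶ x'} {g : y ⟶ y'} {m : x ⇸ y} {n : x' ⇸ y'} (cf cf' : Companion f)
    (cg cg' : Companion g) (α : Cell m n) (hf : src α = f) (hg : tgt α = g) :
    slideCompanion cf cg α hf hg ≫ (cf.uniqueIso cf').hom ▷ₚ n =
      m ◁ₚ (cg.uniqueIso cg').hom ≫ slideCompanion cf' cg' α hf hg := by
  have natural := slideCompanion_naturality cf cg α hf hg cf' cg' α hf hg (𝟙 _) (𝟙 _)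
    ((Category.id_comp α).trans (Category.comp_id α).symm) (by simp) (by simp)
  simp only [src_id, tgt_id] at natural
  exact glob_ext natural

end Companion

theorem isCommuter_iff_isIso_slideCompanion {D : Type u} [DoubleCategory.{t, w, v} D]
    {x y x' y' : D} {f : x ⟶ x'} {g : y ⟶ y'} {m : x ⇸ y} {n : x' ⇸ y'} (cf : Companion f)
    (cg : Companion g) (α : Cell m n) (hf : src α = f) (hg : tgt α = g) :
    IsCommuter α ↔ IsIso (slideCompanion cf cg α hf hg) := by
  subst hf hg
  refine ⟨fun hα => hα.2.2 cf cg, fun _ => ⟨⟨cf⟩, ⟨cg⟩, fun cf' cg' => ?_⟩⟩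
  rw [← (IsIso.inv_comp_eq _).mpr (Companion.slideCompanion_uniqueIso cf cf' cg cg' α rfl rfl)]
  infer_instance

/-- The horizontal opposite of a double category: the arrows are unchanged, and a proarrow `x ⇸ y`
of `HOp D` is a proarrow `y ⇸ x` of `D`. Cells of `HOp D` are cells of `D` with the two boundary
arrows exchanged. -/
def HOp (D : Type u) : Type u := D

section
variable {D : Type u} [DoubleCategory.{t, w, v} D]

instance : PreDoubleCategory.{t, w, v} (HOp D) where
  toCategory := inferInstanceAs (Category D)
  Pro x y := Pro (D := D) y x
  cellCategory :=
    { Hom := fun P Q => Cell (D := D) P.pro Q.pro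
      id := fun P => 𝟙 (Loose.mk (Pro := Pro (D := D)) P.pro)
      comp := fun α β => CategoryStruct.comp (obj := Loose (Pro (D := D))) α β
      id_comp := fun α => Category.id_comp (obj := Loose (Pro (D := D))) α
      comp_id := fun α => Category.comp_id (obj := Loose (Pro (D := D))) α
      assoc := fun α β γ => Category.assoc (obj := Loose (Pro (D := D))) α β γ }
  src α := tgt (D := D) α
  tgt α := src (D := D) α
  src_id _ := tgt_id (D := D) _
  tgt_id _ := src_id (D := D) _
  src_comp α β := tgt_comp (D := D) α β
  tgt_comp α β := src_comp (D := D) α β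

/-- A globular cell, regarded in the horizontal opposite. -/
def Glob.hop {x y : D} {m n : x ⇸ y} (φ : m ⟶ n) : Glob (D := HOp D) (x := y) (y := x) m n :=
  ⟨φ.cell, φ.tgt_cell, φ.src_cell⟩

/-- An invertible globular cell, regarded in the horizontal opposite. -/
def Glob.isoHop {x y : D} {m n : x ⇸ y} (e : m ≅ n) :
    @Iso (Pro (D := HOp D) y x) (globCategory (D := HOp D) y x) m n :=
  @Iso.mk _ (globCategory (D := HOp D) y x) _ _ (Glob.hop e.hom) (Glob.hop e.inv)
    (Glob.ext (D := HOp D) (cell_hom_inv_id e)) (Glob.ext (D := HOp D) (cell_inv_hom_id e))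

instance : DoubleCategory.{t, w, v} (HOp D) where
  hid x := hid (D := D) x
  hidMap f := hidMap (D := D) f
  src_hidMap f := tgt_hidMap (D := D) f
  tgt_hidMap f := src_hidMap (D := D) f
  hidMap_id x := hidMap_id (D := D) x
  hidMap_comp f g := hidMap_comp (D := D) f g
  hcomp m n := hcomp (D := D) n m
  hcompMap α β h := hcompMap (D := D) β α h.symm
  src_hcompMap α β h := tgt_hcompMap (D := D) β α h.symm
  tgt_hcompMap α β h := src_hcompMap (D := D) β α h.symm
  hcompMap_id m n := hcompMap_id (D := D) n m
  hcompMap_comp α β α' β' h h' := hcompMap_comp (D := D) β α β' α' h.symm h'.symm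
  hassoc m n p := Glob.isoHop (@Iso.symm _ (globCategory (D := D) _ _) _ _ (hassoc (D := D) p n m))
  hassoc_naturality α β γ h h' := hassoc_inv_naturality (D := D) γ β α h'.symm h.symm
  leftUnitor m := Glob.isoHop (rightUnitor (D := D) m)
  leftUnitor_naturality α := rightUnitor_naturality (D := D) α
  rightUnitor m := Glob.isoHop (leftUnitor (D := D) m)
  rightUnitor_naturality α := leftUnitor_naturality (D := D) α
  pentagon m n p q := congrArg Glob.cell
    (Bicategory.pentagon_inv (B := UBicat D) q p n m)
  triangle m n := congrArg Glob.cell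
    (Bicategory.triangle_assoc_comp_right (B := UBicat D) n m)

/-- A conjoint is a companion in the horizontal opposite. -/
def Conjoint.hop {x y : D} {f : x ⟶ y} (c : Conjoint f) :
    Companion (D := HOp D) (x := x) (y := y) f where
  pro := c.pro
  unit := c.unit
  src_unit := c.tgt_unit
  tgt_unit := c.src_unit
  counit := c.counit
  src_counit := c.tgt_counit
  tgt_counit := c.src_counit
  unit_hcomp_counit := c.counit_hcomp_unit
  unit_comp_counit := c.unit_comp_counit

end

namespace Conjoint

attribute [simp] Conjoint.src_unit Conjoint.tgt_unit Conjoint.src_counit Conjoint.tgt_counit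

section
variable {D : Type u} [DoubleCategory.{t, w, v} D] {x y x' y' : D} {f : x ⟶ y} {g : x' ⟶ y'}

/-- The cell `f^* ⟶ g^*` induced by a commutative square of arrows. -/
def map (c : Conjoint f) (d : Conjoint g) (u : x ⟶ x') (v : y ⟶ y') (h : u ≫ g = f ≫ v) :
    Cell c.pro d.pro :=
  c.hop.map d.hop u v h

variable (c : Conjoint f) (d : Conjoint g) (u : x ⟶ x') (v : y ⟶ y') (h : u ≫ g = f ≫ v)

@[simp] theorem src_map : src (c.map d u v h) = v := c.hop.tgt_map d.hop u v h

@[simp] theorem tgt_map : tgt (c.map d u v h) = u := c.hop.src_map d.hop u v h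

theorem unit_map : c.unit ≫ c.map d u v h = hidMap u ≫ d.unit := c.hop.unit_map d.hop u v h

theorem map_counit : c.map d u v h ≫ d.counit = c.counit ≫ hidMap v :=
  c.hop.map_counit d.hop u v h

theorem map_id : c.map c (𝟙 x) (𝟙 y) (by simp) = 𝟙 (Loose.mk c.pro) := c.hop.map_id

theorem map_comp {x'' y'' : D} {k : x'' ⟶ y''} (e : Conjoint k) (u' : x' ⟶ x'') (v' : y' ⟶ y'')
    (h' : u' ≫ k = g ≫ v') :
    c.map e (u ≫ u') (v ≫ v') (by rw [Category.assoc, h', reassoc_of% h]) =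
      c.map d u v h ≫ d.map e u' v' h' :=
  c.hop.map_comp d.hop u v h e.hop u' v' h'

/-- The canonical isomorphism between two conjoints of the same arrow. -/
def uniqueIso (c c' : Conjoint f) : c.pro ≅ c'.pro where
  hom := ⟨c.map c' (𝟙 x) (𝟙 y) (by simp), by simp, by simp⟩
  inv := ⟨c'.map c (𝟙 x) (𝟙 y) (by simp), by simp, by simp⟩
  hom_inv_id := glob_ext (c.hop.map_id_comp_map_id c'.hop)
  inv_hom_id := glob_ext (c'.hop.map_id_comp_map_id c.hop)

end

section
variable {D : Type u} [DoubleCategory.{t, w, v} D] {x y x' y' : D}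
  {f : x ⟶ x'} {g : y ⟶ y'} {m : x ⇸ y} {n : x' ⇸ y'}
  (cf : Conjoint f) (cg : Conjoint g) (α : Cell m n) (hf : src α = f) (hg : tgt α = g)

theorem unit_slideConjoint :
    hcompMap cf.unit (𝟙 (Loose.mk m)) (by simp) ≫ (slideConjoint cf cg α hf hg).cell =
      (idCmp m).cell ≫ hcompMap α cg.unit (by simp [hg]) :=
  Companion.unit_slideCompanion cg.hop cf.hop α hg hf

theorem slideConjoint_eq_of_unit {S : cf.pro ⊙ m ⟶ n ⊙ cg.pro}
    (h : hcompMap cf.unit (𝟙 (Loose.mk m)) (by simp) ≫ S.cell =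
      (idCmp m).cell ≫ hcompMap α cg.unit (by simp [hg])) :
    slideConjoint cf cg α hf hg = S :=
  glob_ext (congrArg (Glob.cell (D := HOp D))
    (Companion.slideCompanion_eq_of_unit cg.hop cf.hop α hg hf (S := Glob.hop S) h))

theorem slideConjoint_counit :
    (slideConjoint cf cg α hf hg).cell ≫ hcompMap (𝟙 (Loose.mk n)) cg.counit (by simp) =
      hcompMap cf.counit α (by simp [hf]) ≫ (idCmp n).cell :=
  Companion.slideCompanion_counit cg.hop cf.hop α hg hf

theorem slideConjoint_naturality {a b a' b' : D} {p : a ⇸ b} {q : a' ⇸ b'} {f' : a ⟶ a'}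
    {g' : b ⟶ b'} (cf' : Conjoint f') (cg' : Conjoint g') (β : Cell p q) (hf' : src β = f')
    (hg' : tgt β = g') (γ : Cell m p) (δ : Cell n q) (h : γ ≫ β = α ≫ δ)
    (hs : src γ ≫ f' = f ≫ src δ) (ht : tgt γ ≫ g' = g ≫ tgt δ) :
    (slideConjoint cf cg α hf hg).cell ≫ hcompMap δ (cg.map cg' _ _ ht) (by simp) =
      hcompMap (cf.map cf' _ _ hs) γ (by simp) ≫ (slideConjoint cf' cg' β hf' hg').cell :=
  Companion.slideCompanion_naturality cg.hop cf.hop α hg hf cg'.hop cf'.hop β hg' hf' γ δ h ht hs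

theorem slideConjoint_comp_glob {p : x ⇸ y} {q : x' ⇸ y'} (β : Cell p q)
    (hβ : src β = f) (hβ' : tgt β = g) (φ : m ⟶ p) (ψ : n ⟶ q) (w : φ.cell ≫ β = α ≫ ψ.cell) :
    cf.pro ◁ₚ φ ≫ slideConjoint cf cg β hβ hβ' = slideConjoint cf cg α hf hg ≫ ψ ▷ₚ cg.pro :=
  glob_ext (congrArg (Glob.cell (D := HOp D))
    (Companion.slideCompanion_comp_glob cg.hop cf.hop α β hg hf hβ' hβ (Glob.hop φ) (Glob.hop ψ) w))

theorem slideConjoint_hidMap :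
    slideConjoint cf cf (hidMap f) (src_hidMap f) (tgt_hidMap f) = (idCmpIso cf.pro).inv :=
  glob_ext (congrArg (Glob.cell (D := HOp D)) (Companion.slideCompanion_hidMap cf.hop))

theorem slideConjoint_hcompMap {z z' : D} {h : z ⟶ z'} (ch : Conjoint h) {m' : y ⇸ z}
    {n' : y' ⇸ z'} (β : Cell m' n') (hβ : src β = g) (hβ' : tgt β = h) :
    slideConjoint cf ch (hcompMap α β (hg.trans hβ.symm)) (by simp [hf]) (by simp [hβ']) =
      (hassoc _ _ _).inv ≫ slideConjoint cf cg α hf hg ▷ₚ m' ≫ (hassoc _ _ _).hom ≫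
        n ◁ₚ slideConjoint cg ch β hβ hβ' ≫ (hassoc _ _ _).inv :=
  glob_ext (congrArg (Glob.cell (D := HOp D))
    (Companion.slideCompanion_hcompMap ch.hop cg.hop cf.hop β α hβ' hβ hg hf))

variable (cf' : Conjoint f) (cg' : Conjoint g)

theorem slideConjoint_uniqueIso :
    slideConjoint cf cg α hf hg ≫ n ◁ₚ (cg.uniqueIso cg').hom =
      (cf.uniqueIso cf').hom ▷ₚ m ≫ slideConjoint cf' cg' α hf hg :=
  glob_ext (congrArg (Glob.cell (D := HOp D))
    (Companion.slideCompanion_uniqueIso cg.hop cg'.hop cf.hop cf'.hop α hg hf))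

end

end Conjoint

theorem isCocommuter_iff_isIso_slideConjoint {D : Type u} [DoubleCategory.{t, w, v} D]
    {x y x' y' : D} {f : x ⟶ x'} {g : y ⟶ y'} {m : x ⇸ y} {n : x' ⇸ y'} (cf : Conjoint f)
    (cg : Conjoint g) (α : Cell m n) (hf : src α = f) (hg : tgt α = g) :
    IsCocommuter α ↔ IsIso (slideConjoint cf cg α hf hg) := by
  subst hf hg
  refine ⟨fun hα => hα.2.2 cf cg, fun _ => ⟨⟨cf⟩, ⟨cg⟩, fun cf' cg' => ?_⟩⟩
  rw [← (IsIso.inv_comp_eq _).mpr (Conjoint.slideConjoint_uniqueIso cf cg α rfl rfl cf' cg')]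
  infer_instance

section
variable {D : Type u₁} [DoubleCategory.{t₁, w₁, v₁} D]
variable {E : Type u₂} [DoubleCategory.{t₂, w₂, v₂} E]
variable {F G : LaxDoubleFunctor D E} (α : NatTransf F G)

namespace NatTransf

section
variable (c : ∀ x, Companion (α.app x))

/-- The globular cell obtained by sliding the boundary arrows of `α_m` along companions. -/
abbrev slideCompanion {x y : D} (m : x ⇸ y) :
    F.mapPro m ⊙ (c y).pro ⟶ (c x).pro ⊙ G.mapPro m :=
  DoubleCat.slideCompanion (c x) (c y) (α.cell m) (α.src_cell m) (α.tgt_cell m)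

theorem slideCompanion_hcomp {x y z : D} (m : x ⇸ y) (n : y ⇸ z) :
    F.laxComp m n ▷ₚ (c z).pro ≫ α.slideCompanion c (m ⊙ n) =
      compCmp (α.slideCompanion c m) (α.slideCompanion c n) ≫ (c x).pro ◁ₚ G.laxComp m n :=
  (Companion.slideCompanion_comp_glob (c x) (c z) _ _ (by simp) (by simp) _ _ _ _
    (α.cell_hcomp m n)).trans (congrArg (· ≫ _) (Companion.slideCompanion_hcompMap ..))

theorem slideCompanion_hid (x : D) :
    F.laxId x ▷ₚ (c x).pro ≫ α.slideCompanion c (hid x) =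
      idCmp (c x).pro ≫ (c x).pro ◁ₚ G.laxId x :=
  (Companion.slideCompanion_comp_glob (c x) (c x) _ _ (by simp) (by simp) _ _ _ _
    (α.cell_hid x)).trans (congrArg (· ≫ _) (Companion.slideCompanion_hidMap _))

variable [∀ {x y : D} (m : x ⇸ y), IsIso (α.slideCompanion c m)]

/-- The pseudo protransformation `α_! : F ⇸ G` formed by the companions of the components of `α`,
whose comparisons are the inverses of the slides of the cells `α_m`. -/
noncomputable def companionProtransf : PseudoProtransf F G where
  pro x := (c x).pro
  arr {x y} f := (c x).map (c y) (F.map f) (G.map f) (α.naturality f)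
  src_arr f := by simp
  tgt_arr f := by simp
  comparison m := inv (α.slideCompanion c m)
  isIso_comparison m := inferInstance
  arr_id x := by simp only [F.map_id, G.map_id, Companion.map_id]
  arr_comp {x y z} f g := by
    simp only [F.map_comp, G.map_comp]
    exact Companion.map_comp ..
  naturality {x y x' y' m n} γ := by
    have natural := Companion.slideCompanion_naturality (c x) (c y) (α.cell m) (α.src_cell m)
      (α.tgt_cell m) (c x') (c y') (α.cell n) (α.src_cell n) (α.tgt_cell n) (F.mapCell γ)
      (G.mapCell γ) (α.cell_naturality γ) (by simp [α.naturality]) (by simp [α.naturality])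
    simp only [F.src_mapCell, F.tgt_mapCell, G.src_mapCell, G.tgt_mapCell] at natural
    exact inv_sq (asIso (α.slideCompanion c m)) (asIso (α.slideCompanion c n)) natural.symm
  comparison_hcomp {x y z} m n := by
    have cancel_left : F.mapPro m ◁ₚ inv (α.slideCompanion c n) ≫
        F.mapPro m ◁ₚ α.slideCompanion c n = 𝟙 _ := by
      rw [← whiskerL_comp, IsIso.inv_hom_id, whiskerL_id]
    have cancel_right : inv (α.slideCompanion c m) ▷ₚ G.mapPro n ≫
        α.slideCompanion c m ▷ₚ G.mapPro n = 𝟙 _ := by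
      rw [← comp_whiskerR, IsIso.inv_hom_id, id_whiskerR]
    rw [IsIso.comp_inv_eq]
    simp only [Category.assoc]
    rw [slideCompanion_hcomp, compCmp]
    simp only [Category.assoc]
    rw [Iso.inv_hom_id_assoc, reassoc_of% cancel_left, Iso.hom_inv_id_assoc,
      reassoc_of% cancel_right, Iso.inv_hom_id_assoc]
  comparison_hid x := by
    rw [IsIso.comp_inv_eq]
    simp only [Category.assoc]
    rw [slideCompanion_hid, idCmp, Category.assoc, Iso.inv_hom_id_assoc, Iso.hom_inv_id_assoc]

/-- The companion of `α` in `LaxPs D E` formed by the companions of its components. -/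
noncomputable def companion : Companion (D := LaxPs D E) (x := F) (y := G) α where
  pro := α.companionProtransf c
  unit :=
    { left := 𝟙 F
      right := α
      app := fun x => (c x).unit
      src_app := fun x => (c x).src_unit
      tgt_app := fun x => (c x).tgt_unit
      arr_equivariance := fun {x y} f => (c x).unit_map (c y) _ _ (α.naturality f)
      pro_equivariance := fun {x y} m =>
        (inv_sq (idCmpIso (F.mapPro m)).symm (asIso (α.slideCompanion c m))
          (Companion.unit_slideCompanion (c x) (c y) (α.cell m) (α.src_cell m)
            (α.tgt_cell m))).symm }
  src_unit := rfl
  tgt_unit := rfl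
  counit :=
    { left := α
      right := 𝟙 G
      app := fun x => (c x).counit
      src_app := fun x => (c x).src_counit
      tgt_app := fun x => (c x).tgt_counit
      arr_equivariance := fun {x y} f => ((c x).map_counit (c y) _ _ (α.naturality f)).symm
      pro_equivariance := fun {x y} m =>
        (inv_sq (asIso (α.slideCompanion c m)) (idCmpIso (G.mapPro m)).symm
          (Companion.slideCompanion_counit (c x) (c y) (α.cell m) (α.src_cell m)
            (α.tgt_cell m)).symm).symm }
  src_counit := rfl
  tgt_counit := rfl
  unit_hcomp_counit := Modif.ext' ((Category.id_comp _).trans (Category.comp_id _))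
    ((Category.id_comp _).trans (Category.comp_id _)) (fun x => (c x).unit_hcomp_counit)
  unit_comp_counit := Modif.ext' (Category.id_comp _) (Category.comp_id _)
    (fun x => (c x).unit_comp_counit)

end

section
variable (c : ∀ x, Conjoint (α.app x))

/-- The globular cell obtained by sliding the boundary arrows of `α_m` along conjoints. -/
abbrev slideConjoint {x y : D} (m : x ⇸ y) :
    (c x).pro ⊙ F.mapPro m ⟶ G.mapPro m ⊙ (c y).pro :=
  DoubleCat.slideConjoint (c x) (c y) (α.cell m) (α.src_cell m) (α.tgt_cell m)

variable [∀ {x y : D} (m : x ⇸ y), IsIso (α.slideConjoint c m)]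

/-- The pseudo protransformation `α^* : G ⇸ F` formed by the conjoints of the components of `α`,
whose comparisons are the slides of the cells `α_m`. -/
def conjointProtransf : PseudoProtransf G F where
  pro x := (c x).pro
  arr {x y} f := (c x).map (c y) (F.map f) (G.map f) (α.naturality f)
  src_arr f := by simp
  tgt_arr f := by simp
  comparison m := α.slideConjoint c m
  isIso_comparison m := inferInstance
  arr_id x := by simp only [F.map_id, G.map_id, Conjoint.map_id]
  arr_comp {x y z} f g := by
    simp only [F.map_comp, G.map_comp]
    exact Conjoint.map_comp ..
  naturality {x y x' y' m n} γ := by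
    have natural := Conjoint.slideConjoint_naturality (c x) (c y) (α.cell m) (α.src_cell m)
      (α.tgt_cell m) (c x') (c y') (α.cell n) (α.src_cell n) (α.tgt_cell n) (F.mapCell γ)
      (G.mapCell γ) (α.cell_naturality γ) (by simp [α.naturality]) (by simp [α.naturality])
    simpa only [F.src_mapCell, F.tgt_mapCell, G.src_mapCell, G.tgt_mapCell] using natural
  comparison_hcomp {x y z} m n := by
    have slide_lax := Conjoint.slideConjoint_comp_glob (c x) (c z) _ (by simp) (by simp)
      _ (α.src_cell (m ⊙ n)) (α.tgt_cell (m ⊙ n)) _ _ (α.cell_hcomp m n)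
    have slide_hcomp := Conjoint.slideConjoint_hcompMap (c x) (c y) (α.cell m) (α.src_cell m)
      (α.tgt_cell m) (c z) (α.cell n) (α.src_cell n) (α.tgt_cell n)
    rw [slide_lax, slide_hcomp]
    simp only [Category.assoc]
  comparison_hid x := by
    have slide_lax := Conjoint.slideConjoint_comp_glob (c x) (c x) _ (by simp) (by simp)
      _ (α.src_cell (hid x)) (α.tgt_cell (hid x)) _ _ (α.cell_hid x)
    rw [slide_lax, Conjoint.slideConjoint_hidMap]
    exact Category.assoc _ _ _

/-- The conjoint of `α` in `LaxPs D E` formed by the conjoints of its components. -/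
def conjoint : Conjoint (D := LaxPs D E) (x := F) (y := G) α where
  pro := α.conjointProtransf c
  unit :=
    { left := α
      right := 𝟙 F
      app := fun x => (c x).unit
      src_app := fun x => (c x).src_unit
      tgt_app := fun x => (c x).tgt_unit
      arr_equivariance := fun {x y} f => (c x).unit_map (c y) _ _ (α.naturality f)
      pro_equivariance := fun {x y} m =>
        Conjoint.unit_slideConjoint (c x) (c y) (α.cell m) (α.src_cell m) (α.tgt_cell m) }
  src_unit := rfl
  tgt_unit := rfl
  counit :=
    { left := 𝟙 G
      right := α
      app := fun x => (c x).counit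
      src_app := fun x => (c x).src_counit
      tgt_app := fun x => (c x).tgt_counit
      arr_equivariance := fun {x y} f => ((c x).map_counit (c y) _ _ (α.naturality f)).symm
      pro_equivariance := fun {x y} m =>
        (Conjoint.slideConjoint_counit (c x) (c y) (α.cell m) (α.src_cell m)
            (α.tgt_cell m)).symm }
  src_counit := rfl
  tgt_counit := rfl
  counit_hcomp_unit := Modif.ext' ((Category.id_comp _).trans (Category.comp_id _))
    ((Category.id_comp _).trans (Category.comp_id _)) (fun x => (c x).counit_hcomp_unit)
  unit_comp_counit := Modif.ext' (Category.comp_id _) (Category.id_comp _)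
    (fun x => (c x).unit_comp_counit)

end

end NatTransf

variable {α}

/-- The component at `x` of a companion in `LaxPs D E`. -/
def Companion.component (C : Companion (D := LaxPs D E) (x := F) (y := G) α) (x : D) :
    Companion (α.app x) where
  pro := (LaxPs.toProtransf C.pro).pro x
  unit := Modif.app C.unit x
  src_unit := (Modif.src_app C.unit x).trans
    (congrArg (fun β : NatTransf F F => β.app x) C.src_unit)
  tgt_unit := (Modif.tgt_app C.unit x).trans
    (congrArg (fun β : NatTransf F G => β.app x) C.tgt_unit)
  counit := Modif.app C.counit x
  src_counit := (Modif.src_app C.counit x).trans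
    (congrArg (fun β : NatTransf F G => β.app x) C.src_counit)
  tgt_counit := (Modif.tgt_app C.counit x).trans
    (congrArg (fun β : NatTransf G G => β.app x) C.tgt_counit)
  unit_hcomp_counit := congrArg (fun μ => Modif.app μ x) C.unit_hcomp_counit
  unit_comp_counit := congrArg (fun μ => Modif.app μ x) C.unit_comp_counit

theorem Companion.slideCompanion_component
    (C : Companion (D := LaxPs D E) (x := F) (y := G) α) {x y : D} (m : x ⇸ y) :
    α.slideCompanion C.component m = inv ((LaxPs.toProtransf C.pro).comparison m) := by
  refine slideCompanion_eq_of_unit _ _ _ _ _ ?_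
  have left_cell : (Modif.left C.unit).cell m = 𝟙 _ :=
    congrArg (fun β : NatTransf F F => β.cell m) C.src_unit
  have right_cell : (Modif.right C.unit).cell m = α.cell m :=
    congrArg (fun β : NatTransf F G => β.cell m) C.tgt_unit
  have equivariant := Modif.pro_equivariance C.unit m
  rw [hcompMap_congr rfl right_cell, hcompMap_congr left_cell rfl] at equivariant
  exact (inv_sq (idCmpIso (F.mapPro m)) (asIso ((LaxPs.toProtransf C.pro).comparison m))
    equivariant).symm

variable (α) in
theorem LaxPs.hasCompanion_iff : HasCompanion (D := LaxPs D E) (x := F) (y := G) α ↔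
    (∀ x : D, HasCompanion (α.app x)) ∧ ∀ (x y : D) (m : x ⇸ y), IsCommuter (α.cell m) := by
  refine ⟨fun ⟨C⟩ => ⟨fun x => ⟨C.component x⟩, fun x y m => ?_⟩, fun ⟨hobj, hpro⟩ => ?_⟩
  · have : IsIso (α.slideCompanion C.component m) := by
      rw [C.slideCompanion_component]
      exact inferInstanceAs (IsIso (inv ((LaxPs.toProtransf C.pro).comparison m)))
    exact (isCommuter_iff_isIso_slideCompanion (C.component x) (C.component y) _ (α.src_cell m)
      (α.tgt_cell m)).mpr this
  · let c x := (hobj x).some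
    have {x y : D} (m : x ⇸ y) : IsIso (α.slideCompanion c m) :=
      (isCommuter_iff_isIso_slideCompanion _ _ _ _ _).mp (hpro x y m)
    exact ⟨α.companion c⟩

/-- The component at `x` of a conjoint in `LaxPs D E`. -/
def Conjoint.component (C : Conjoint (D := LaxPs D E) (x := F) (y := G) α) (x : D) :
    Conjoint (α.app x) where
  pro := (LaxPs.toProtransf C.pro).pro x
  unit := Modif.app C.unit x
  src_unit := (Modif.src_app C.unit x).trans
    (congrArg (fun β : NatTransf F G => β.app x) C.src_unit)
  tgt_unit := (Modif.tgt_app C.unit x).trans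
    (congrArg (fun β : NatTransf F F => β.app x) C.tgt_unit)
  counit := Modif.app C.counit x
  src_counit := (Modif.src_app C.counit x).trans
    (congrArg (fun β : NatTransf G G => β.app x) C.src_counit)
  tgt_counit := (Modif.tgt_app C.counit x).trans
    (congrArg (fun β : NatTransf F G => β.app x) C.tgt_counit)
  counit_hcomp_unit := congrArg (fun μ => Modif.app μ x) C.counit_hcomp_unit
  unit_comp_counit := congrArg (fun μ => Modif.app μ x) C.unit_comp_counit

theorem Conjoint.slideConjoint_component
    (C : Conjoint (D := LaxPs D E) (x := F) (y := G) α) {x y : D} (m : x ⇸ y) :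
    α.slideConjoint C.component m = (LaxPs.toProtransf C.pro).comparison m := by
  refine slideConjoint_eq_of_unit _ _ _ _ _ ?_
  have left_cell : (Modif.left C.unit).cell m = α.cell m :=
    congrArg (fun β : NatTransf F G => β.cell m) C.src_unit
  have right_cell : (Modif.right C.unit).cell m = 𝟙 _ :=
    congrArg (fun β : NatTransf F F => β.cell m) C.tgt_unit
  have equivariant := Modif.pro_equivariance C.unit m
  rwa [hcompMap_congr rfl right_cell, hcompMap_congr left_cell rfl] at equivariant

variable (α) in
theorem LaxPs.hasConjoint_iff : HasConjoint (D := LaxPs D E) (x := F) (y := G) α ↔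
    (∀ x : D, HasConjoint (α.app x)) ∧ ∀ (x y : D) (m : x ⇸ y), IsCocommuter (α.cell m) := by
  refine ⟨fun ⟨C⟩ => ⟨fun x => ⟨C.component x⟩, fun x y m => ?_⟩, fun ⟨hobj, hpro⟩ => ?_⟩
  · have : IsIso (α.slideConjoint C.component m) := by
      rw [C.slideConjoint_component]
      exact (LaxPs.toProtransf C.pro).isIso_comparison m
    exact (isCocommuter_iff_isIso_slideConjoint (C.component x) (C.component y) _ (α.src_cell m)
      (α.tgt_cell m)).mpr this
  · let c x := (hobj x).some
    have {x y : D} (m : x ⇸ y) : IsIso (α.slideConjoint c m) :=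
      (isCocommuter_iff_isIso_slideConjoint _ _ _ _ _).mp (hpro x y m)
    exact ⟨α.conjoint c⟩

end
end DoubleCat

theorem mainTheorem5
    {D : Type u₁} [DoubleCategory.{t₁, w₁, v₁} D]
    {E : Type u₂} [DoubleCategory.{t₂, w₂, v₂} E]
    (F G : LaxDoubleFunctor D E) (α : NatTransf F G) :
    (HasCompanion (D := LaxPs D E) (x := F) (y := G) α ↔
      (∀ x : D, HasCompanion (α.app x)) ∧
        ∀ (x y : D) (m : x ⇸ y), IsCommuter (α.cell m)) ∧
    (HasConjoint (D := LaxPs D E) (x := F) (y := G) α ↔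
      (∀ x : D, HasConjoint (α.app x)) ∧
        ∀ (x y : D) (m : x ⇸ y), IsCocommuter (α.cell m)) :=
  ⟨LaxPs.hasCompanion_iff α, LaxPs.hasConjoint_iff α⟩
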